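/- Let $n\ge 1$ be an integer, and let $\langle\cdot,\cdot\rangle$ be the standard inner product and $|\cdot|$ the Lebesgue measure on $\mathbb{R}^n$. Let $K\subset\mathbb{R}^n$ be a convex body, that is, a compact convex set with non-empty interior. Assume that $K$ is isotropic: $|K|=1$, the barycenter of $K$ is the origin, and there is a constant $L_K$ such that $\int_K\langle x,u\rangle^2\,dx=L_K^2$ for every unit vector $u\in\mathbb{R}^n$. Assume also that $K$ is unconditional: $K$ is symmetric with respect to all $n$ coordinate hyperplanes. Let $\mu_K$ be the cone probability measure on the boundary $\partial K$, given by $$\mu_K(B)=\frac{|\{rx:x\in B,\ 0\le r\le 1\}|}{|K|}\qquad\text{for every Borel set }B\subset\partial K .$$ Then, for every $\theta\in\mathbb{R}^n$, $$\inf\Bigl\{\lambda>0:\int_{\partial K}\Bigl(\exp\bigl(\langle x,\theta\rangle^2/\lambda^2\bigr)-1\Bigr)\,d\mu_K(x)\le 1\Bigr\}\ \le\ 3\sqrt{n}\,\|\theta\|_\infty ,\qquad \|\theta\|_\infty=\max_{1\le i\le n}|\theta_i| ,$$ that is, the $\psi_2$-norm (the Luxemburg norm for $\psi_2(x)=\exp(x^2)-1$)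 of the linear functional $\langle\cdot,\theta\rangle$ with respect to $\mu_K$ is at most $3\sqrt{n}\,\|\theta\|_\infty$. -/

import Mathlib

open MeasureTheory Set
open scoped ENNReal Pointwise

/-- The Luxemburg norm `inf {t > 0 : 𝔼 M(|X| / t) ≤ 1}` of `X` with respect to `μ` and the Orlicz
function `M`, with values in `[0, ∞]`; it is `∞` if no `t` is admissible. -/
noncomputable def luxemburgNorm {Ω : Type*} [MeasurableSpace Ω] (M : ℝ → ℝ) (X : Ω → ℝ)
    (μ : Measure Ω) : ℝ≥0∞ :=
  ⨅ (t : ℝ) (_ : 0 < t) (_ : ∫⁻ ω, ENNReal.ofReal (M (|X ω| / t)) ∂μ ≤ 1), ENNReal.ofReal t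

/-- The Orlicz function `ψ₂(x) = exp(x²) - 1`. -/
noncomputable def psiTwo (x : ℝ) : ℝ := Real.exp (x ^ 2) - 1

/-- The `ψ₂`-norm of `X` with respect to `μ`. -/
noncomputable def psiTwoNorm {Ω : Type*} [MeasurableSpace Ω] (X : Ω → ℝ) (μ : Measure Ω) : ℝ≥0∞ :=
  luxemburgNorm psiTwo X μ

namespace ConvexBody

variable {n : ℕ}

/-- `K` is isotropic: it has volume one, its barycenter is the origin, and the second moments
`∫_K ⟨x, u⟩² dx` in all unit directions `u` have a common value `L²`. -/
structure IsIsotropic (K : ConvexBody (EuclideanSpace ℝ (Fin n))) : Prop where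
  volume_eq_one : volume (K : Set (EuclideanSpace ℝ (Fin n))) = 1
  barycenter_eq_zero : ∫ x in (K : Set (EuclideanSpace ℝ (Fin n))), x = 0
  exists_isotropic_constant : ∃ L : ℝ, ∀ u : EuclideanSpace ℝ (Fin n), ‖u‖ = 1 →
    ∫ x in (K : Set (EuclideanSpace ℝ (Fin n))), (inner ℝ x u) ^ 2 = L ^ 2

/-- `K` is unconditional: it is invariant under `x_i ↦ -x_i` for every coordinate `i`. -/
def IsUnconditional (K : ConvexBody (EuclideanSpace ℝ (Fin n))) : Prop :=
  ∀ i : Fin n, ∀ x ∈ K, WithLp.toLp 2 (Function.update x.ofLp i (-x i)) ∈ K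

theorem IsUnconditional.neg_mem {K : ConvexBody (EuclideanSpace ℝ (Fin n))}
    (hK : K.IsUnconditional) {x : EuclideanSpace ℝ (Fin n)} (hx : x ∈ K) : -x ∈ K := by
  have key : ∀ s : Finset (Fin n),
      (WithLp.toLp 2 (fun i => if i ∈ s then -x i else x i) : EuclideanSpace ℝ (Fin n)) ∈ K := by
    intro s
    induction s using Finset.induction_on with
    | empty => simpa using hx
    | insert a s ha ih =>
      have h := hK a _ ih
      convert h using 2
      funext j
      by_cases hj : j = a
      · subst hj; simp [ha]
      · simp [hj]
  have h := key Finset.univ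
  convert h using 1
  ext i
  simp

/-- An unconditional convex body with non-empty interior contains the origin in its interior. -/
theorem IsUnconditional.zero_mem_interior {K : ConvexBody (EuclideanSpace ℝ (Fin n))}
    (hK : K.IsUnconditional) (hint : (interior (K : Set (EuclideanSpace ℝ (Fin n)))).Nonempty) :
    (0 : EuclideanSpace ℝ (Fin n)) ∈ interior (K : Set (EuclideanSpace ℝ (Fin n))) := by
  obtain ⟨x, hx⟩ := hint
  have hsymm : -(K : Set (EuclideanSpace ℝ (Fin n))) = K := by
    ext y
    refine ⟨fun h => ?_, fun h => hK.neg_mem h⟩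
    have := hK.neg_mem (x := -y) h
    simpa using this
  have hnx : -x ∈ interior (K : Set (EuclideanSpace ℝ (Fin n))) := by
    have h := (Homeomorph.neg (EuclideanSpace ℝ (Fin n))).preimage_interior
      (K : Set (EuclideanSpace ℝ (Fin n)))
    have h2 : (Homeomorph.neg (EuclideanSpace ℝ (Fin n))) ⁻¹' (K : Set (EuclideanSpace ℝ (Fin n)))
        = K := hsymm
    rw [h2] at h
    rw [← h] at hx
    exact hx
  have := K.convex.interior hx hnx (a := 1 / 2) (b := 1 / 2) (by norm_num) (by norm_num)
    (by norm_num)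
  simpa using this

section Cone

variable {K : ConvexBody (EuclideanSpace ℝ (Fin n))}

theorem measurableSet_cone
    (h0 : (0 : EuclideanSpace ℝ (Fin n)) ∈ interior (K : Set (EuclideanSpace ℝ (Fin n))))
    {B : Set (EuclideanSpace ℝ (Fin n))} (hB : MeasurableSet B)
    (hBK : B ⊆ frontier (K : Set (EuclideanSpace ℝ (Fin n)))) :
    MeasurableSet (Icc (0 : ℝ) 1 • B) := by
  have hnhds := mem_interior_iff_mem_nhds.1 h0
  have hg : Measurable (gauge (K : Set (EuclideanSpace ℝ (Fin n)))) :=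
    (continuous_gauge K.convex hnhds).measurable
  rcases B.eq_empty_or_nonempty with rfl | ⟨b, hb⟩
  · simp
  have hS : Icc (0 : ℝ) 1 • B = {y | gauge (K : Set (EuclideanSpace ℝ (Fin n))) y ≤ 1 ∧
      (gauge (K : Set (EuclideanSpace ℝ (Fin n))) y)⁻¹ • y ∈ B} ∪ {0} := by
    ext y
    constructor
    · rintro ⟨r, hr, x, hx, rfl⟩
      have hx1 := (gauge_eq_one_iff_mem_frontier K.convex hnhds).2 (hBK hx)
      rcases hr.1.eq_or_lt with h | h
      · right; simp [← h]
      · left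
        have hgr : gauge (K : Set (EuclideanSpace ℝ (Fin n))) (r • x) = r := by
          rw [gauge_smul_of_nonneg hr.1, hx1]; simp
        simp only [mem_ofPred_eq, hgr]
        refine ⟨hr.2, ?_⟩
        rwa [smul_smul, inv_mul_cancel₀ h.ne', one_smul]
    · rintro (⟨h1, h2⟩ | h)
      · refine ⟨_, ⟨gauge_nonneg y, h1⟩, _, h2, ?_⟩
        have hne : gauge (K : Set (EuclideanSpace ℝ (Fin n))) y ≠ 0 := by
          intro h
          have := hBK h2
          rw [h, inv_zero, zero_smul] at this
          exact this.2 h0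
        simp only [smul_smul, mul_inv_cancel₀ hne, one_smul]
      · rw [mem_singleton_iff.1 h]
        exact ⟨0, by simp, b, hb, by simp⟩
  rw [hS]
  refine MeasurableSet.union (MeasurableSet.inter (measurableSet_le hg measurable_const) ?_)
    (measurableSet_singleton 0)
  exact (hg.inv.smul measurable_id) hB

theorem aedisjoint_cone
    (h0 : (0 : EuclideanSpace ℝ (Fin n)) ∈ interior (K : Set (EuclideanSpace ℝ (Fin n))))
    {A B : Set (EuclideanSpace ℝ (Fin n))}
    (hAK : A ⊆ frontier (K : Set (EuclideanSpace ℝ (Fin n))))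
    (hBK : B ⊆ frontier (K : Set (EuclideanSpace ℝ (Fin n)))) (hAB : Disjoint A B) :
    AEDisjoint volume (Icc (0 : ℝ) 1 • A) (Icc (0 : ℝ) 1 • B) := by
  have hnhds := mem_interior_iff_mem_nhds.1 h0
  rcases A.eq_empty_or_nonempty with rfl | ⟨a, ha⟩
  · simp [AEDisjoint]
  have hane : a ≠ 0 := by
    rintro rfl
    exact (hAK ha).2 h0
  have : Nontrivial (EuclideanSpace ℝ (Fin n)) := ⟨a, 0, hane⟩
  refine measure_mono_null (t := {0}) ?_ (measure_singleton _)
  rintro y ⟨⟨r, hr, x, hx, rfl⟩, ⟨s, hs, z, hz, hy⟩⟩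
  have hx1 := (gauge_eq_one_iff_mem_frontier K.convex hnhds).2 (hAK hx)
  have hz1 := (gauge_eq_one_iff_mem_frontier K.convex hnhds).2 (hBK hz)
  simp only at hy
  have hrs : s = r := by
    have := congrArg (gauge (K : Set (EuclideanSpace ℝ (Fin n)))) hy
    rw [gauge_smul_of_nonneg hr.1, gauge_smul_of_nonneg hs.1, hx1, hz1] at this
    simpa using this
  subst hrs
  by_contra hne
  have hs0 : s ≠ 0 := by
    rintro rfl
    simp at hne
  have hzx : z = x := smul_right_injective _ hs0 hy
  subst hzx
  exact disjoint_left.1 hAB hx hz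

end Cone

/-- The cone measure on the boundary of a convex body `K` with the origin in its interior:
`μ_K(B) = |{r x : x ∈ B, 0 ≤ r ≤ 1}| / |K|` for every Borel set `B ⊆ ∂K`. -/
noncomputable def coneMeasure (K : ConvexBody (EuclideanSpace ℝ (Fin n)))
    (h0 : (0 : EuclideanSpace ℝ (Fin n)) ∈ interior (K : Set (EuclideanSpace ℝ (Fin n)))) :
    Measure (frontier (K : Set (EuclideanSpace ℝ (Fin n)))) :=
  Measure.ofMeasurable
    (fun B _ => volume (Icc (0 : ℝ) 1 • ((↑) '' B : Set (EuclideanSpace ℝ (Fin n)))) /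
      volume (K : Set (EuclideanSpace ℝ (Fin n))))
    (by simp)
    (by
      intro f hf hdisj
      have hm : ∀ i, MeasurableSet ((↑) '' f i : Set (EuclideanSpace ℝ (Fin n))) := fun i =>
        isClosed_frontier.measurableSet.subtype_image (hf i)
      have hsub : ∀ i, ((↑) '' f i : Set (EuclideanSpace ℝ (Fin n))) ⊆
          frontier (K : Set (EuclideanSpace ℝ (Fin n))) := fun i => by
        rintro _ ⟨x, _, rfl⟩
        exact x.2
      rw [image_iUnion, smul_iUnion, measure_iUnion₀]
      · simp only [div_eq_mul_inv, ENNReal.tsum_mul_right]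
      · intro i j hij
        exact aedisjoint_cone h0 (hsub i) (hsub j)
          ((disjoint_image_iff Subtype.val_injective).2 (hdisj hij))
      · exact fun i => (measurableSet_cone h0 (hm i) (hsub i)).nullMeasurableSet)

end ConvexBody

/-! By unconditionality everything takes place in the positive orthant, where the gauge `N` of `K`
is sublinear and coordinatewise monotone. Expanding `exp`, the bound follows from the even moments
`∫ ⟨x,θ⟩^(2k) dμ_K ≤ ½ (2/3)^k k! (3√n ‖θ‖_∞)^(2k)`, because `∑_{k≥1} ½ (2/3)^k = 1`.

Monomial moments are computed for the density `e^(-N)` and carried to `K` by homogeneity. The tail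
`α ↦ ∫_{x ≥ α} e^(-N)` is log-concave by Prékopa–Leindler, and its logarithmic slopes at the origin
are at most `-c_i`, with `c_i = r_i / n` and `r_i` the volume of the facet `x_i = 0` divided by that
of the orthant part of `K`. A log-concave function lies below its tangent, so the tail is at most
its value at `0` times `∏ e^(-c_i α_i)` (`expTail_le`). Integrating this bound gives moments at most
those of independent exponential variables (`lintegral_monomial_mul_expNeg_le`).

Isotropy supplies `r_i² ≥ 2/3` (`two_thirds_le_facetRatio_sq`). The moment bound for `x_j²` gives
`L_K² r_j² ≤ 2`, Loomis–Whitney gives `∏ r_j ≥ 2^n`, hence `L_K² ≤ 1/2`. Conversely, no section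
parallel to a facet is larger than the facet, which forces `L_K² ≥ 1 / (3 r_i²)`.

In the multinomial expansion of `⟨x,θ⟩^(2k)` only even exponents survive, and all these terms obey
one bound (`factorial_mul_setIntegral_pow_le`). The cone measure contributes a factor `(n + 2k) / n`
(`lintegral_coneMeasure_of_homogeneous`), and a binomial estimate finishes
(`choose_mul_factorial_mul_pow_le`). -/

/-! ### Prékopa–Leindler for antitone functions on the half-line. -/

theorem volume_le_iSup_ofReal {S : Set ℝ} (hS : S ⊆ Ici 0) :
    volume S ≤ ⨆ x ∈ S, ENNReal.ofReal x := by
  by_cases hb : BddAbove S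
  · rcases S.eq_empty_or_nonempty with rfl | hne
    · simp
    have h1 : S ⊆ Icc 0 (sSup S) := fun x hx => ⟨hS hx, le_csSup hb hx⟩
    refine (measure_mono h1).trans ?_
    rw [Real.volume_Icc, sub_zero]
    refine le_of_forall_lt fun c hc => ?_
    have hc' : c.toReal < sSup S := (ENNReal.lt_ofReal_iff_toReal_lt hc.ne_top).1 hc
    obtain ⟨x, hx, hcx⟩ := exists_lt_of_lt_csSup hne hc'
    exact ((ENNReal.lt_ofReal_iff_toReal_lt hc.ne_top).2 hcx).trans_le
      (le_iSup₂ (f := fun x (_ : x ∈ S) => ENNReal.ofReal x) x hx)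
  · have : (⨆ x ∈ S, ENNReal.ofReal x) = ⊤ := by
      refine ENNReal.eq_top_of_forall_nnreal_le fun r => ?_
      obtain ⟨x, hx, hrx⟩ := not_bddAbove_iff.1 hb r
      refine le_trans ?_ (le_iSup₂ (f := fun x (_ : x ∈ S) => ENNReal.ofReal x) x hx)
      rw [← ENNReal.ofReal_coe_nnreal]
      exact ENNReal.ofReal_le_ofReal hrx.le
    simp [this]

/-- One-dimensional Brunn–Minkowski inequality for initial segments of the half-line. -/
theorem volume_add_le_of_initial {S T U : Set ℝ} {s : ℝ} (hs0 : 0 < s) (hs1 : s < 1)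
    (hS : S ⊆ Ici 0) (hT : T ⊆ Ici 0) (hSne : S.Nonempty) (hTne : T.Nonempty)
    (hSi : ∀ x ∈ S, Icc 0 x ⊆ S) (hTi : ∀ x ∈ T, Icc 0 x ⊆ T)
    (hU : ∀ x ∈ S, ∀ y ∈ T, s * x + (1 - s) * y ∈ U) :
    ENNReal.ofReal s * volume S + ENNReal.ofReal (1 - s) * volume T ≤ volume U := by
  have key : ∀ x ∈ S, ∀ y ∈ T,
      ENNReal.ofReal s * ENNReal.ofReal x + ENNReal.ofReal (1 - s) * ENNReal.ofReal y
        ≤ volume U := by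
    intro x hx y hy
    have hx0 : 0 ≤ x := hS hx
    have hy0 : 0 ≤ y := hT hy
    have h1s : 0 < 1 - s := by linarith
    have hz0 : 0 ≤ s * x + (1 - s) * y := by positivity
    have hsub : Icc 0 (s * x + (1 - s) * y) ⊆ U := by
      rintro z ⟨hz, hz'⟩
      rcases hz0.eq_or_lt with h | h
      · have := hU x hx y hy
        rwa [show z = s * x + (1 - s) * y by linarith]
      -- Shrinking `x` and `y` by the common factor `r` stays inside the initial segments and
      -- reaches every point of `[0, s x + (1 - s) y]`.
      · set r := z / (s * x + (1 - s) * y) with hr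
        have hr0 : 0 ≤ r := by positivity
        have hr1 : r ≤ 1 := (div_le_one h).2 hz'
        have := hU (r * x) (hSi x hx ⟨by positivity, mul_le_of_le_one_left hx0 hr1⟩)
          (r * y) (hTi y hy ⟨by positivity, mul_le_of_le_one_left hy0 hr1⟩)
        have e : s * (r * x) + (1 - s) * (r * y) = z := by
          rw [show s * (r * x) + (1 - s) * (r * y) = r * (s * x + (1 - s) * y) by ring, hr]
          field_simp
        rwa [e] at this
    calc _ = ENNReal.ofReal (s * x + (1 - s) * y) := by
          rw [ENNReal.ofReal_add (by positivity) (by positivity), ENNReal.ofReal_mul hs0.le,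
            ENNReal.ofReal_mul h1s.le]
      _ = volume (Icc 0 (s * x + (1 - s) * y)) := by simp
      _ ≤ volume U := measure_mono hsub
  refine (add_le_add (mul_le_mul_right (volume_le_iSup_ofReal hS) _)
    (mul_le_mul_right (volume_le_iSup_ofReal hT) _)).trans ?_
  simp only [ENNReal.mul_iSup]
  exact ENNReal.biSup_add_biSup_le' hSne hTne key

/-- Layer cake: superlevel sets of antitone functions are initial segments, so Brunn–Minkowski
applies level by level. The normalisation at `0` makes both superlevel sets nonempty exactly for `t
< 1`; for larger `t` both are empty. -/
theorem lintegral_add_le_of_min_le {f g h : ℝ → ℝ} {s : ℝ} (hs0 : 0 < s) (hs1 : s < 1)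
    (hf : AntitoneOn f (Ici 0)) (hg : AntitoneOn g (Ici 0)) (hf0 : ∀ x, 0 ≤ x → 0 ≤ f x)
    (hg0 : ∀ x, 0 ≤ x → 0 ≤ g x)
    (hh0 : ∀ x, 0 ≤ x → 0 ≤ h x) (hf1 : f 0 = 1) (hg1 : g 0 = 1) (hh : Measurable h)
    (H : ∀ x y, 0 ≤ x → 0 ≤ y → min (f x) (g y) ≤ h (s * x + (1 - s) * y)) :
    ENNReal.ofReal s * (∫⁻ x in Ici 0, ENNReal.ofReal (f x)) +
      ENNReal.ofReal (1 - s) * (∫⁻ x in Ici 0, ENNReal.ofReal (g x)) ≤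
      ∫⁻ x in Ici 0, ENNReal.ofReal (h x) := by
  have nn : ∀ {u : ℝ → ℝ}, (∀ x, 0 ≤ x → 0 ≤ u x) → 0 ≤ᵐ[volume.restrict (Ici 0)] u :=
    fun hu => (ae_restrict_iff' measurableSet_Ici).2 (ae_of_all _ fun x hx => hu x hx)
  rw [lintegral_eq_lintegral_meas_lt _ (nn hf0)
      (aemeasurable_restrict_of_antitoneOn measurableSet_Ici hf),
    lintegral_eq_lintegral_meas_lt _ (nn hg0)
      (aemeasurable_restrict_of_antitoneOn measurableSet_Ici hg),
    lintegral_eq_lintegral_meas_lt _ (nn hh0) hh.aemeasurable]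
  have hm : ∀ u : ℝ → ℝ, Measurable fun t => (volume.restrict (Ici (0 : ℝ))) {a | t < u a} :=
    fun u => Antitone.measurable fun a b hab => measure_mono fun x (hx : b < u x) => hab.trans_lt hx
  rw [← lintegral_const_mul _ (hm f), ← lintegral_const_mul _ (hm g),
    ← lintegral_add_left ((hm f).const_mul _)]
  refine setLIntegral_mono' measurableSet_Ioi fun t ht => ?_
  rw [Measure.restrict_apply' measurableSet_Ici, Measure.restrict_apply' measurableSet_Ici,
    Measure.restrict_apply' measurableSet_Ici]
  by_cases ht1 : t < 1
  · refine volume_add_le_of_initial hs0 hs1 inter_subset_right inter_subset_right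
      ⟨0, by simpa [hf1] using ht1⟩ ⟨0, by simpa [hg1] using ht1⟩ ?_ ?_ ?_
    · rintro x ⟨hx, hx0⟩ y ⟨hy0, hyx⟩
      exact ⟨lt_of_lt_of_le hx (hf hy0 hx0 hyx), hy0⟩
    · rintro x ⟨hx, hx0⟩ y ⟨hy0, hyx⟩
      exact ⟨lt_of_lt_of_le hx (hg hy0 hx0 hyx), hy0⟩
    · rintro x ⟨hx, hx0⟩ y ⟨hy, hy0⟩
      have h1s : 0 ≤ 1 - s := by linarith
      exact ⟨lt_of_lt_of_le (lt_min hx hy) (H x y hx0 hy0),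
        add_nonneg (mul_nonneg hs0.le hx0) (mul_nonneg h1s hy0)⟩
  · have e1 : {a | t < f a} ∩ Ici 0 = ∅ := by
      ext x
      simp only [mem_inter_iff, mem_ofPred_eq, mem_Ici, mem_empty_iff_false, iff_false, not_and]
      intro hx hx0
      have := hf (self_mem_Ici) hx0 hx0
      linarith
    have e2 : {a | t < g a} ∩ Ici 0 = ∅ := by
      ext x
      simp only [mem_inter_iff, mem_ofPred_eq, mem_Ici, mem_empty_iff_false, iff_false, not_and]
      intro hx hx0
      have := hg (self_mem_Ici) hx0 hx0
      linarith
    simp [e1, e2]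

theorem ENNReal.rpow_mul_rpow_le_weighted_add {a b : ℝ≥0∞} {s : ℝ} (hs0 : 0 < s) (hs1 : s < 1) :
    a ^ s * b ^ (1 - s) ≤ ENNReal.ofReal s * a + ENNReal.ofReal (1 - s) * b := by
  have h1s : 0 < 1 - s := by linarith
  rcases eq_or_ne a ⊤ with rfl | ha
  · simp [ENNReal.mul_top, hs0]
  rcases eq_or_ne b ⊤ with rfl | hb
  · simp [ENNReal.mul_top, h1s, hs1]
  lift a to NNReal using ha
  lift b to NNReal using hb
  have h := NNReal.geom_mean_le_arith_mean2_weighted s.toNNReal (1 - s).toNNReal a b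
    (by rw [← Real.toNNReal_add hs0.le h1s.le]; simp)
  rw [Real.coe_toNNReal _ hs0.le, Real.coe_toNNReal _ h1s.le] at h
  rw [← ENNReal.coe_rpow_of_nonneg _ hs0.le, ← ENNReal.coe_rpow_of_nonneg _ h1s.le]
  change _ ≤ (s.toNNReal : ℝ≥0∞) * a + ((1 - s).toNNReal : ℝ≥0∞) * b
  exact_mod_cast h

/-- Dividing `f` and `g` by their maxima, attained at `0`, turns the geometric-mean hypothesis into
one on `min`. This yields an arithmetic mean of integrals, which dominates the geometric mean. -/
theorem lintegral_prekopaLeindler_of_ne_top {f g h : ℝ → ℝ≥0∞} {s : ℝ} (hs0 : 0 < s) (hs1 : s < 1)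
    (hf : AntitoneOn f (Ici 0)) (hg : AntitoneOn g (Ici 0)) (hh : Measurable h)
    (hf0 : f 0 ≠ ⊤) (hg0 : g 0 ≠ ⊤)
    (H : ∀ x y, 0 ≤ x → 0 ≤ y → f x ^ s * g y ^ (1 - s) ≤ h (s * x + (1 - s) * y)) :
    (∫⁻ x in Ici 0, f x) ^ s * (∫⁻ x in Ici 0, g x) ^ (1 - s) ≤ ∫⁻ x in Ici 0, h x := by
  have h1s : 0 < 1 - s := by linarith
  have zero : ∀ {u : ℝ → ℝ≥0∞}, AntitoneOn u (Ici 0) → u 0 = 0 → ∫⁻ x in Ici 0, u x = 0 := by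
    intro u hu hu0
    refine (setLIntegral_congr_fun (g := fun _ => 0) measurableSet_Ici fun x hx => ?_).trans (by simp)
    exact le_antisymm ((hu self_mem_Ici hx hx).trans hu0.le) (zero_le)
  rcases eq_or_ne (f 0) 0 with hf00 | hf00
  · simp [zero hf hf00, hs0]
  rcases eq_or_ne (g 0) 0 with hg00 | hg00
  · simp [zero hg hg00, hs1]
  set F := f 0
  set G := g 0
  set C := F ^ s * G ^ (1 - s) with hC
  have hFs : F ^ s ≠ 0 := by simp [ENNReal.rpow_eq_zero_iff, hf00, hf0]
  have hGs : G ^ (1 - s) ≠ 0 := by simp [ENNReal.rpow_eq_zero_iff, hg00, hg0]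
  have hC0 : C ≠ 0 := mul_ne_zero hFs hGs
  have hCt : C ≠ ⊤ := ENNReal.mul_ne_top (ENNReal.rpow_ne_top_of_nonneg hs0.le hf0)
    (ENNReal.rpow_ne_top_of_nonneg h1s.le hg0)
  have le1 : ∀ {u : ℝ → ℝ≥0∞}, AntitoneOn u (Ici 0) → ∀ x, 0 ≤ x → u x / u 0 ≤ 1 :=
    fun hu x hx => ENNReal.div_le_of_le_mul (by simpa using hu self_mem_Ici hx hx)
  have anti : ∀ {u : ℝ → ℝ≥0∞}, AntitoneOn u (Ici 0) →
      AntitoneOn (fun x => (u x / u 0).toReal) (Ici 0) := fun hu x hx y hy hxy =>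
    ENNReal.toReal_mono (ne_top_of_le_ne_top ENNReal.one_ne_top (le1 hu x hx))
      (ENNReal.div_le_div_right (hu hx hy hxy) _)
  -- Truncating `h / C` at `1` loses nothing, since the normalised `f` and `g` are at most `1`, and
  -- keeps `toReal` away from `⊤`.
  have key := lintegral_add_le_of_min_le (f := fun x => (f x / F).toReal)
    (g := fun x => (g x / G).toReal) (h := fun x => (min (h x / C) 1).toReal) hs0 hs1
    (anti hf) (anti hg) (fun _ _ => ENNReal.toReal_nonneg) (fun _ _ => ENNReal.toReal_nonneg)
    (fun _ _ => ENNReal.toReal_nonneg)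
    (by simp [F, ENNReal.div_self hf00 hf0]) (by simp [G, ENNReal.div_self hg00 hg0])
    ((hh.div_const C).min measurable_const).ennreal_toReal (by
      intro x y hx hy
      have ht : min (h (s * x + (1 - s) * y) / C) 1 ≠ ⊤ :=
        ne_top_of_le_ne_top ENNReal.one_ne_top (min_le_right _ _)
      have hm : min (f x / F) (g y / G) ≤ min (h (s * x + (1 - s) * y) / C) 1 := by
        refine le_min ?_ ((min_le_left _ _).trans (le1 hf x hx))
        set m := min (f x / F) (g y / G)
        calc m = m ^ s * m ^ (1 - s) := by
              rw [← ENNReal.rpow_add_of_nonneg _ _ hs0.le h1s.le]; simp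
          _ ≤ (f x / F) ^ s * (g y / G) ^ (1 - s) :=
              mul_le_mul' (ENNReal.rpow_le_rpow (min_le_left _ _) hs0.le)
                (ENNReal.rpow_le_rpow (min_le_right _ _) h1s.le)
          _ = (f x ^ s * g y ^ (1 - s)) / C := by
              rw [ENNReal.div_rpow_of_nonneg _ _ hs0.le, ENNReal.div_rpow_of_nonneg _ _ h1s.le, hC,
                ENNReal.mul_div_mul_comm (Or.inl hFs)
                  (Or.inr hGs)]
          _ ≤ _ := ENNReal.div_le_div_right (H x y hx hy) _
      rcases le_total (f x / F) (g y / G) with hle | hle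
      · rw [min_eq_left hle] at hm
        exact (min_le_left _ _).trans (ENNReal.toReal_mono ht hm)
      · rw [min_eq_right hle] at hm
        exact (min_le_right _ _).trans (ENNReal.toReal_mono ht hm))
  have ef : ∀ {u : ℝ → ℝ≥0∞}, AntitoneOn u (Ici 0) →
      ∫⁻ x in Ici 0, ENNReal.ofReal (u x / u 0).toReal = (∫⁻ x in Ici 0, u x) / u 0 := by
    intro u hu
    rw [div_eq_mul_inv, ← lintegral_mul_const'' _
      (aemeasurable_restrict_of_antitoneOn measurableSet_Ici hu)]
    refine setLIntegral_congr_fun measurableSet_Ici fun x hx => ?_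
    exact ENNReal.ofReal_toReal (ne_top_of_le_ne_top ENNReal.one_ne_top (le1 hu x hx))
  have eh : ∫⁻ x in Ici 0, ENNReal.ofReal (min (h x / C) 1).toReal ≤
      (∫⁻ x in Ici 0, h x) / C := by
    rw [div_eq_mul_inv, ← lintegral_mul_const _ hh]
    refine lintegral_mono fun x => ?_
    exact ENNReal.ofReal_toReal_le.trans (min_le_left _ _)
  rw [ef hf, ef hg] at key
  have h2 := (ENNReal.rpow_mul_rpow_le_weighted_add hs0 hs1).trans (key.trans eh)
  rw [ENNReal.div_rpow_of_nonneg _ _ hs0.le, ENNReal.div_rpow_of_nonneg _ _ h1s.le,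
    ← ENNReal.mul_div_mul_comm (Or.inl hFs)
      (Or.inr hGs), ← hC] at h2
  simpa only [ENNReal.div_mul_cancel hC0 hCt] using mul_le_mul_left h2 C

theorem iSup_min_natCast (a : ℝ≥0∞) : ⨆ k : ℕ, min a (k : ℝ≥0∞) = a := by
  rw [← inf_iSup_eq, ENNReal.iSup_natCast, inf_top_eq]

/-- Prékopa–Leindler inequality for antitone functions on the half-line. -/
theorem lintegral_prekopaLeindler_Ici {f g h : ℝ → ℝ≥0∞} {s : ℝ} (hs0 : 0 < s) (hs1 : s < 1)
    (hf : AntitoneOn f (Ici 0)) (hg : AntitoneOn g (Ici 0)) (hh : Measurable h)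
    (H : ∀ x y, 0 ≤ x → 0 ≤ y → f x ^ s * g y ^ (1 - s) ≤ h (s * x + (1 - s) * y)) :
    (∫⁻ x in Ici 0, f x) ^ s * (∫⁻ x in Ici 0, g x) ^ (1 - s) ≤ ∫⁻ x in Ici 0, h x := by
  have h1s : 0 < 1 - s := by linarith
  have anti : ∀ {u : ℝ → ℝ≥0∞}, AntitoneOn u (Ici 0) → ∀ k : ℕ,
      AntitoneOn (fun x => min (u x) (k : ℝ≥0∞)) (Ici 0) := fun hu k x hx y hy hxy =>
    min_le_min_right _ (hu hx hy hxy)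
  -- The values at `0` may be infinite: truncation at integers reduces to the finite case, and
  -- monotone convergence recovers the integrals.
  have sup : ∀ {u : ℝ → ℝ≥0∞}, AntitoneOn u (Ici 0) → ∀ {p : ℝ}, 0 < p →
      (∫⁻ x in Ici 0, u x) ^ p = ⨆ k : ℕ, (∫⁻ x in Ici 0, min (u x) (k : ℝ≥0∞)) ^ p := by
    intro u hu p hp
    have e : ∫⁻ x in Ici 0, u x = ⨆ k : ℕ, ∫⁻ x in Ici 0, min (u x) (k : ℝ≥0∞) := by
      rw [← lintegral_iSup'
        (fun k => aemeasurable_restrict_of_antitoneOn measurableSet_Ici (anti hu k))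
        (ae_of_all _ fun x i j hij => min_le_min_left _ (by exact_mod_cast hij))]
      simp_rw [iSup_min_natCast]
    rw [e]
    exact (ENNReal.orderIsoRpow p hp).map_iSup _
  have mono : ∀ (u : ℝ → ℝ≥0∞) {p : ℝ}, 0 < p →
      Monotone fun k : ℕ => (∫⁻ x in Ici 0, min (u x) (k : ℝ≥0∞)) ^ p := fun u p hp i j hij =>
    ENNReal.rpow_le_rpow (lintegral_mono fun x => min_le_min_left _ (by exact_mod_cast hij)) hp.le
  rw [sup hf hs0, sup hg h1s, ENNReal.iSup_mul]
  refine iSup_le fun i => ?_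
  rw [ENNReal.mul_iSup]
  refine iSup_le fun j => ?_
  set k := max i j
  refine (mul_le_mul' (mono f hs0 (le_max_left i j)) (mono g h1s (le_max_right i j))).trans ?_
  refine (lintegral_prekopaLeindler_of_ne_top hs0 hs1 (anti hf k) (anti hg k)
    (h := h) hh ?_ ?_ ?_)
  · exact ne_top_of_le_ne_top (ENNReal.natCast_ne_top k) (min_le_right _ _)
  · exact ne_top_of_le_ne_top (ENNReal.natCast_ne_top k) (min_le_right _ _)
  · intro x y hx hy
    refine le_trans ?_ (H x y hx hy)
    gcongr
    · exact min_le_left _ _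
    · exact min_le_left _ _

/-! ### Prékopa–Leindler on the positive orthant, by induction on coordinates. -/

section Orthant

variable {ι : Type*} [DecidableEq ι]

/-- Lebesgue measure restricted to the half-line `[0, ∞)`, for every coordinate. -/
noncomputable abbrev halfLine (_ : ι) : Measure ℝ := volume.restrict (Ici 0)

/-- Marginals keep the monotonicity that the one-dimensional inequality needs at each induction
step. -/
theorem lmarginal_halfLine_antitone {f : (ι → ℝ) → ℝ≥0∞} (hf : Measurable f)
    (h : ∀ x y, 0 ≤ x → x ≤ y → f y ≤ f x) (T : Finset ι) (x y : ι → ℝ) (hx : 0 ≤ x)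
    (hxy : x ≤ y) : (∫⋯∫⁻_T, f ∂halfLine) y ≤ (∫⋯∫⁻_T, f ∂halfLine) x := by
  induction T using Finset.induction generalizing x y with
  | empty => simpa using h x y hx hxy
  | insert j T hj ih =>
    rw [lmarginal_insert _ hf hj, lmarginal_insert _ hf hj]
    refine setLIntegral_mono' measurableSet_Ici fun t ht => ih _ _ ?_ ?_
    · intro i
      by_cases hi : i = j
      · subst hi; simpa using ht
      · simpa [hi] using hx i
    · intro i
      by_cases hi : i = j
      · subst hi; simp
      · simpa [hi] using hxy i

/-- Prékopa–Leindler inequality for coordinatewise antitone functions on the positive orthant. -/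
theorem lmarginal_prekopaLeindler {f g h : (ι → ℝ) → ℝ≥0∞} {s : ℝ} (hs0 : 0 < s) (hs1 : s < 1)
    (hfm : Measurable f) (hgm : Measurable g) (hhm : Measurable h)
    (hf : ∀ x y, 0 ≤ x → x ≤ y → f y ≤ f x) (hg : ∀ x y, 0 ≤ x → x ≤ y → g y ≤ g x)
    (H : ∀ x y, 0 ≤ x → 0 ≤ y → f x ^ s * g y ^ (1 - s) ≤ h (s • x + (1 - s) • y))
    (T : Finset ι) (x y : ι → ℝ) (hx : 0 ≤ x) (hy : 0 ≤ y) :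
    (∫⋯∫⁻_T, f ∂halfLine) x ^ s * (∫⋯∫⁻_T, g ∂halfLine) y ^ (1 - s) ≤
      (∫⋯∫⁻_T, h ∂halfLine) (s • x + (1 - s) • y) := by
  have upd : ∀ (x : ι → ℝ) (j : ι) (t : ℝ), 0 ≤ x → 0 ≤ t → 0 ≤ Function.update x j t := by
    intro x j t hx ht i
    by_cases hi : i = j
    · subst hi; simpa using ht
    · simpa [hi] using hx i
  induction T using Finset.induction generalizing x y with
  | empty => simpa using H x y hx hy
  | insert j T hj ih =>
    rw [lmarginal_insert _ hfm hj, lmarginal_insert _ hgm hj, lmarginal_insert _ hhm hj]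
    have anti : ∀ {u : (ι → ℝ) → ℝ≥0∞}, Measurable u → (∀ x y, 0 ≤ x → x ≤ y → u y ≤ u x) →
        ∀ x, 0 ≤ x → AntitoneOn (fun t => (∫⋯∫⁻_T, u ∂halfLine) (Function.update x j t)) (Ici 0) :=
      fun hum hu x hx a ha b hb hab => lmarginal_halfLine_antitone hum hu T _ _ (upd x j a hx ha)
        (Function.update_mono hab)
    refine lintegral_prekopaLeindler_Ici hs0 hs1 (anti hfm hf x hx) (anti hgm hg y hy)
      ((hhm.lmarginal _).comp (measurable_update _)) fun a b ha hb => ?_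
    have := ih (Function.update x j a) (Function.update y j b) (upd x j a hx ha) (upd y j b hy hb)
    convert this using 2
    ext i
    by_cases hi : i = j
    · subst hi; simp
    · simp [hi]

end Orthant

/-! ### The Loomis–Whitney inequality. -/

section LoomisWhitney

variable {ι : Type*} [DecidableEq ι] {μ : ι → Measure ℝ} [∀ i, SigmaFinite (μ i)]

/-- Induction on the integrated coordinates: `f j` does not depend on `x j` and leaves the new
integral, and Hölder with equal exponents `p = 1 / (|s| - 1)` treats the remaining `|s| - 1`
factors. -/
theorem lmarginal_prod_rpow_le {p : ℝ} (hp : 0 ≤ p) {s : Finset ι} (hps : (s.card - 1 : ℝ) * p = 1)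
    {f : ι → (ι → ℝ) → ℝ≥0∞}
    (hf : ∀ i, Measurable (f i)) (hfu : ∀ i x t, f i (Function.update x i t) = f i x)
    (T : Finset ι) (hT : T ⊆ s) (x : ι → ℝ) :
    (∫⋯∫⁻_T, (fun x => ∏ i ∈ s, f i x ^ p) ∂μ) x ≤
      ∏ i ∈ s, (∫⋯∫⁻_(T.erase i), f i ∂μ) x ^ p := by
  have hm : Measurable fun x => ∏ i ∈ s, f i x ^ p :=
    Finset.measurable_prod _ fun i _ => (hf i).pow_const p
  induction T using Finset.induction generalizing x with
  | empty => simp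
  | insert j T hj ih =>
    have hjs : j ∈ s := hT (Finset.mem_insert_self _ _)
    rw [lmarginal_insert _ hm hj]
    have hconst : ∀ t, (∫⋯∫⁻_(T.erase j), f j ∂μ) (Function.update x j t) =
        (∫⋯∫⁻_((insert j T).erase j), f j ∂μ) x := by
      intro t
      rw [Finset.erase_insert hj, Finset.erase_eq_of_notMem hj, lmarginal_update_of_notMem (hf j) hj,
        show f j ∘ (Function.update · j t) = f j from funext fun y => hfu j y t]
    have hcard : (∑ _i ∈ s.erase j, p) = 1 := by
      rw [Finset.sum_const, Finset.card_erase_of_mem hjs, nsmul_eq_mul,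
        Nat.cast_sub (Finset.card_pos.2 ⟨j, hjs⟩)]
      simpa using hps
    calc ∫⁻ t, (∫⋯∫⁻_T, (fun x => ∏ i ∈ s, f i x ^ p) ∂μ) (Function.update x j t) ∂μ j
        ≤ ∫⁻ t, ∏ i ∈ s, (∫⋯∫⁻_(T.erase i), f i ∂μ) (Function.update x j t) ^ p ∂μ j :=
          lintegral_mono fun t => ih (fun a ha => hT (Finset.mem_insert_of_mem ha)) _
      _ = (∫⋯∫⁻_((insert j T).erase j), f j ∂μ) x ^ p *
          ∫⁻ t, ∏ i ∈ s.erase j, (∫⋯∫⁻_(T.erase i), f i ∂μ) (Function.update x j t) ^ p ∂μ j := by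
          rw [← lintegral_const_mul]
          · refine lintegral_congr fun t => ?_
            rw [← Finset.mul_prod_erase s _ hjs, hconst t]
          · exact Finset.measurable_prod _ fun i _ =>
              (((hf i).lmarginal _).comp (measurable_update _)).pow_const p
      _ ≤ (∫⋯∫⁻_((insert j T).erase j), f j ∂μ) x ^ p * ∏ i ∈ s.erase j,
          (∫⁻ t, (∫⋯∫⁻_(T.erase i), f i ∂μ) (Function.update x j t) ∂μ j) ^ p := by
          gcongr
          exact ENNReal.lintegral_prod_norm_pow_le (s.erase j) (p := fun _ => p)
            (fun i _ => (((hf i).lmarginal _).comp (measurable_update _)).aemeasurable) hcard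
            (fun _ _ => hp)
      _ = ∏ i ∈ s, (∫⋯∫⁻_((insert j T).erase i), f i ∂μ) x ^ p := by
          rw [← Finset.mul_prod_erase s _ hjs]
          congr 1
          refine Finset.prod_congr rfl fun i hi => ?_
          have hij : i ≠ j := Finset.ne_of_mem_erase hi
          rw [Finset.erase_insert_of_ne hij.symm, lmarginal_insert _ (hf i)
            (fun h => hj (Finset.mem_of_mem_erase h))]

/-- The Loomis–Whitney inequality for a set contained in the cylinders over its coordinate
projections. -/
theorem lintegral_pow_le_prod_lmarginal [Fintype ι]
    {f : ι → (ι → ℝ) → ℝ≥0∞} {g : (ι → ℝ) → ℝ≥0∞}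
    (hf : ∀ i, Measurable (f i)) (hfu : ∀ i x t, f i (Function.update x i t) = f i x)
    (hf1 : ∀ i x, f i x = 0 ∨ f i x = 1)
    (hg : ∀ x, g x ≤ ∏ i, f i x) (hg1 : 1 < Fintype.card ι) (x : ι → ℝ) :
    (∫⁻ x, g x ∂Measure.pi μ) ^ (Fintype.card ι - 1) ≤
      ∏ i, (∫⋯∫⁻_{i}ᶜ, f i ∂μ) x := by
  have hc : (0 : ℝ) < (Fintype.card ι : ℝ) - 1 := by
    have : (1 : ℝ) < Fintype.card ι := by exact_mod_cast hg1
    linarith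
  set p : ℝ := ((Fintype.card ι : ℝ) - 1)⁻¹ with hp
  have h := lmarginal_prod_rpow_le (μ := μ) (inv_nonneg.2 hc.le) (s := Finset.univ)
    (by rw [Finset.card_univ, mul_inv_cancel₀ hc.ne']) hf hfu Finset.univ subset_rfl x
  have h1 : ∫⁻ x, g x ∂Measure.pi μ ≤ (∏ i, (∫⋯∫⁻_{i}ᶜ, f i ∂μ) x) ^ p := by
    rw [← ENNReal.prod_rpow_of_nonneg (inv_nonneg.2 hc.le)]
    simp only [Finset.compl_eq_univ_sdiff, Finset.sdiff_singleton_eq_erase]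
    refine le_trans ?_ h
    rw [lmarginal_univ]
    refine lintegral_mono fun y => (hg y).trans (Finset.prod_le_prod' fun i _ => ?_)
    rcases hf1 i y with h0 | h0 <;> simp [h0]
  calc _ ≤ ((∏ i, (∫⋯∫⁻_{i}ᶜ, f i ∂μ) x) ^ p) ^ (Fintype.card ι - 1) := by gcongr
    _ = _ := by
      rw [← ENNReal.rpow_natCast, ← ENNReal.rpow_mul, Nat.cast_sub hg1.le, Nat.cast_one,
        inv_mul_cancel₀ hc.ne', ENNReal.rpow_one]

end LoomisWhitney

/-! ### Radial integration of homogeneous functions. -/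

section Homogeneous

variable {E : Type*} [NormedAddCommGroup E] [NormedSpace ℝ E] [FiniteDimensional ℝ E]
  [MeasurableSpace E] [BorelSpace E] {μ : Measure E} [μ.IsAddHaarMeasure]

theorem lintegral_comp_smul_of_pos {f : E → ℝ≥0∞} (hf : Measurable f) {t : ℝ} (ht : 0 < t) :
    ∫⁻ x, f x ∂μ = ENNReal.ofReal (t ^ Module.finrank ℝ E) * ∫⁻ x, f (t • x) ∂μ := by
  have h := Measure.map_addHaar_smul μ ht.ne'
  rw [← lintegral_map hf (measurable_const_smul t), h, lintegral_smul_measure, smul_eq_mul,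
    ← mul_assoc, ← ENNReal.ofReal_mul (by positivity), abs_of_pos (by positivity),
    mul_inv_cancel₀ (by positivity)]
  simp

/-- Integration of a homogeneous function against a radial profile `∫_{N x}^∞ φ`. -/
theorem lintegral_homogeneous_mul {F : E → ℝ≥0∞} {N : E → ℝ} {φ : ℝ → ℝ≥0∞} {d : ℕ}
    (hF : Measurable F) (hN : Measurable N) (hφ : Measurable φ)
    (hFh : ∀ t : ℝ, 0 < t → ∀ x, F (t • x) = ENNReal.ofReal (t ^ d) * F x)
    (hNh : ∀ t : ℝ, 0 < t → ∀ x, N (t • x) = t * N x) :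
    ∫⁻ x, F x * (∫⁻ t in Ioi 0 ∩ Ici (N x), φ t) ∂μ =
      (∫⁻ t in Ioi 0, φ t * ENNReal.ofReal (t ^ (Module.finrank ℝ E + d))) *
        ∫⁻ x in {x | N x ≤ 1}, F x ∂μ := by
  have hS : MeasurableSet {p : E × ℝ | N p.1 ≤ p.2} :=
    measurableSet_le (hN.comp measurable_fst) measurable_snd
  have e1 : ∀ x, F x * (∫⁻ t in Ioi 0 ∩ Ici (N x), φ t) =
      ∫⁻ t in Ioi 0, {p : E × ℝ | N p.1 ≤ p.2}.indicator (fun p => F p.1 * φ p.2) (x, t) := by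
    intro x
    rw [← lintegral_const_mul _ hφ, inter_comm, ← Measure.restrict_restrict measurableSet_Ici,
      ← lintegral_indicator measurableSet_Ici]
    rfl
  simp_rw [e1]
  have hsw : AEMeasurable (Function.uncurry fun x t => {p : E × ℝ | N p.1 ≤ p.2}.indicator
      (fun p => F p.1 * φ p.2) (x, t)) (μ.prod (volume.restrict (Ioi 0))) :=
    (((hF.comp measurable_fst).mul (hφ.comp measurable_snd)).indicator hS).aemeasurable
  have hφm : Measurable fun t => φ t * ENNReal.ofReal (t ^ (Module.finrank ℝ E + d)) :=
    hφ.mul (by fun_prop)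
  rw [lintegral_lintegral_swap hsw, ← lintegral_mul_const _ hφm]
  refine setLIntegral_congr_fun measurableSet_Ioi fun t (ht : 0 < t) => ?_
  have hm : Measurable fun x => {p : E × ℝ | N p.1 ≤ p.2}.indicator
      (fun p => F p.1 * φ p.2) (x, t) :=
    (((hF.comp measurable_fst).mul (hφ.comp measurable_snd)).indicator hS).comp
      measurable_prodMk_right
  -- After the swap, `x ↦ t • x` carries `{N ≤ 1}` onto `{N ≤ t}`; the Jacobian and the degree of
  -- `F` together give `t ^ (dim + d)`.
  have hin : ∫⁻ x, {p : E × ℝ | N p.1 ≤ p.2}.indicator (fun p => F p.1 * φ p.2) (t • x, t) ∂μ =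
      ENNReal.ofReal (t ^ d) * φ t * ∫⁻ x in {x | N x ≤ 1}, F x ∂μ := by
    rw [← lintegral_indicator (measurableSet_le hN measurable_const),
      ← lintegral_const_mul _ (hF.indicator (measurableSet_le hN measurable_const))]
    refine lintegral_congr fun x => ?_
    have hiff : N (t • x) ≤ t ↔ N x ≤ 1 := by
      rw [hNh t ht]
      exact mul_le_iff_le_one_right ht
    by_cases hx : N x ≤ 1
    · simp only [indicator, mem_ofPred_eq, hiff, hx, if_true, hFh t ht]
      ring
    · simp only [indicator, mem_ofPred_eq, hiff, hx, if_false, mul_zero]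
  rw [lintegral_comp_smul_of_pos hm ht, hin, pow_add, ENNReal.ofReal_mul (by positivity)]
  ring

end Homogeneous

/-! ### Exponential decay of the tails of `exp (-N)`. -/

section Tail

variable {ι : Type*} [Fintype ι] {N : (ι → ℝ) → ℝ}

/-- A nonnegative sublinear function which is monotone on the positive orthant. -/
structure IsMonotoneGauge (N : (ι → ℝ) → ℝ) : Prop where
  cont : Continuous N
  smul : ∀ t : ℝ, 0 ≤ t → ∀ x, N (t • x) = t * N x
  add_le : ∀ x y, N (x + y) ≤ N x + N y
  mono : ∀ x y, 0 ≤ x → x ≤ y → N x ≤ N y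
  nonneg : ∀ x, 0 ≤ N x

/-- The density `exp (-N)`. -/
noncomputable def expNeg (N : (ι → ℝ) → ℝ) (y : ι → ℝ) : ℝ≥0∞ := ENNReal.ofReal (Real.exp (-N y))

theorem IsMonotoneGauge.measurable_expNeg (hN : IsMonotoneGauge N) : Measurable (expNeg N) :=
  (Real.measurable_exp.comp hN.cont.measurable.neg).ennreal_ofReal

/-- The mass of `exp (-N)` on the translated orthant `{x | α ≤ x}`. -/
noncomputable def expTail (N : (ι → ℝ) → ℝ) (α : ι → ℝ) : ℝ≥0∞ :=
  ∫⁻ y, expNeg N (α + y) ∂Measure.pi halfLine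

variable [DecidableEq ι]

/-- The mass of `exp (-N)` on the facet `x i = 0` of the positive orthant. -/
noncomputable def expFacet (N : (ι → ℝ) → ℝ) (i : ι) : ℝ≥0∞ :=
  (∫⋯∫⁻_{i}ᶜ, expNeg N ∂halfLine) 0

theorem lintegral_pi_eq_lintegral_lmarginal {μ : ι → Measure ℝ} [∀ i, SigmaFinite (μ i)]
    {f : (ι → ℝ) → ℝ≥0∞} (hf : Measurable f) (i : ι) :
    ∫⁻ y, f y ∂Measure.pi μ =
      ∫⁻ t, (∫⋯∫⁻_{i}ᶜ, f ∂μ) (Function.update 0 i t) ∂μ i := by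
  rw [lintegral_eq_lmarginal_univ (0 : ι → ℝ), lmarginal_erase _ hf (Finset.mem_univ i),
    Finset.compl_eq_univ_sdiff, Finset.sdiff_singleton_eq_erase]

/-- The two tails differ by a slab of width `h`. For `0 ≤ t < h` and `y` on the facet, `N (β + t e_i
+ y) ≤ N (β + h e_i) + N y`, so the density on the slab is bounded below by a product. -/
theorem expTail_add_single_add_le (hN : IsMonotoneGauge N) {β : ι → ℝ} (hβ : 0 ≤ β) (i : ι)
    {h : ℝ} (hh : 0 ≤ h) :
    expTail N (β + Pi.single i h) +
      ENNReal.ofReal h * (expNeg N (β + Pi.single i h) * expFacet N i) ≤ expTail N β := by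
  have hm : ∀ γ : ι → ℝ, Measurable fun y => expNeg N (γ + y) := fun γ =>
    hN.measurable_expNeg.comp (measurable_const_add γ)
  have hi : i ∉ ({i}ᶜ : Finset ι) := by simp
  set Φ : ℝ → ℝ≥0∞ := fun t =>
    (∫⋯∫⁻_{i}ᶜ, (fun y => expNeg N (β + y)) ∂halfLine) (Function.update 0 i t) with hΦ
  have e1 : expTail N β = ∫⁻ t in Ici 0, Φ t := lintegral_pi_eq_lintegral_lmarginal (hm β) i
  have e2 : expTail N (β + Pi.single i h) = ∫⁻ t in Ici h, Φ t := by
    rw [expTail, lintegral_pi_eq_lintegral_lmarginal (hm _) i]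
    have : ∀ t, (∫⋯∫⁻_{i}ᶜ, (fun y => expNeg N (β + Pi.single i h + y)) ∂halfLine)
        (Function.update 0 i t) = Φ (t + h) := by
      intro t
      rw [hΦ]
      dsimp only
      rw [lmarginal_update_of_notMem (hm _) hi, lmarginal_update_of_notMem (hm _) hi]
      have e : ∀ y : ι → ℝ, β + Pi.single i h + Function.update y i t =
          β + Function.update y i (t + h) := by
        intro y
        ext j
        by_cases hj : j = i
        · subst hj; simp; ring
        · simp [hj]
      have e' : (fun y => expNeg N (β + Pi.single i h + y)) ∘ (Function.update · i t) =
          (fun y => expNeg N (β + y)) ∘ (Function.update · i (t + h)) :=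
        funext fun y => congrArg (expNeg N) (e y)
      rw [e']
    simp_rw [this]
    rw [← lintegral_indicator measurableSet_Ici, ← lintegral_indicator measurableSet_Ici,
      ← lintegral_add_right_eq_self (fun t => (Ici h).indicator Φ t) h]
    refine lintegral_congr fun t => ?_
    simp [indicator]
  have e3 : ENNReal.ofReal h * (expNeg N (β + Pi.single i h) * expFacet N i) ≤
      ∫⁻ t in Ico 0 h, Φ t := by
    have : ∫⁻ _t in Ico 0 h, (expNeg N (β + Pi.single i h) * expFacet N i) ≤
        ∫⁻ t in Ico 0 h, Φ t := by
      refine setLIntegral_mono' measurableSet_Ico fun t ht => ?_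
      have e4 : expFacet N i = (∫⋯∫⁻_{i}ᶜ, (expNeg N ∘ (Function.update · i 0)) ∂halfLine) 0 := by
        rw [← lmarginal_update_of_notMem hN.measurable_expNeg hi, expFacet]
        congr 1
        simp
      rw [e4, hΦ]
      dsimp only
      rw [lmarginal_update_of_notMem (hm _) hi, lmarginal, lmarginal, ← lintegral_const_mul]
      · refine lintegral_mono fun z => ?_
        set y := Function.updateFinset (0 : ι → ℝ) {i}ᶜ z
        simp only [Function.comp_apply, expNeg]
        rw [← ENNReal.ofReal_mul (Real.exp_nonneg _), ← Real.exp_add]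
        refine ENNReal.ofReal_le_ofReal (Real.exp_le_exp.2 ?_)
        have h1 : β + Function.update y i t = (β + Pi.single i t) + Function.update y i 0 := by
          ext j
          by_cases hj : j = i
          · subst hj; simp
          · simp [hj]
        have h2 : N (β + Pi.single i t) ≤ N (β + Pi.single i h) := by
          refine hN.mono _ _ (add_nonneg hβ (Pi.single_nonneg.2 ht.1)) ?_
          gcongr
          exact ht.2.le
        have h3 := hN.add_le (β + Pi.single i t) (Function.update y i 0)
        rw [h1]
        linarith
      · have hu : Measurable fun y : ι → ℝ => Function.update y i 0 := measurable_update_left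
        exact (hN.measurable_expNeg.comp hu).comp measurable_updateFinset
    refine le_trans (le_of_eq ?_) this
    rw [setLIntegral_const, Real.volume_Ico, sub_zero, mul_comm]
  rw [e1, e2, ← Ico_union_Ici_eq_Ici hh, lintegral_union measurableSet_Ici
    (by rw [Set.disjoint_left]; intro x hx hx'; exact absurd hx.2 (not_lt.2 hx')), add_comm]
  gcongr

/-- Raising the coordinates from `0` to `a` one at a time removes one slab each, and `expNeg N a`
bounds all the intermediate densities from below. This controls the slope of the tail at the origin.
-/
theorem expTail_add_le (hN : IsMonotoneGauge N) {a : ι → ℝ} (ha : 0 ≤ a) :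
    expTail N a + expNeg N a * ∑ i, ENNReal.ofReal (a i) * expFacet N i ≤ expTail N 0 := by
  have key : ∀ T : Finset ι, expTail N (T.piecewise a 0) +
      expNeg N a * ∑ i ∈ T, ENNReal.ofReal (a i) * expFacet N i ≤ expTail N 0 := by
    intro T
    induction T using Finset.induction with
    | empty => simp
    | insert i T hi ih =>
      have hT0 : 0 ≤ T.piecewise a 0 := fun j => by
        by_cases hj : j ∈ T
        · simpa [hj] using ha j
        · simp [hj]
      have e : (insert i T).piecewise a 0 = T.piecewise a 0 + Pi.single i (a i) := by
        ext j
        by_cases hj : j = i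
        · subst hj; simp [hi]
        · by_cases hjT : j ∈ T <;> simp [hj, hjT]
      have hle : (insert i T).piecewise a 0 ≤ a := fun j => by
        by_cases hj : j ∈ insert i T
        · rw [Finset.piecewise_eq_of_mem _ _ _ hj]
        · rw [Finset.piecewise_eq_of_notMem _ _ _ hj]; exact ha j
      have h0 : 0 ≤ (insert i T).piecewise a 0 := by
        rw [e]; exact add_nonneg hT0 (Pi.single_nonneg.2 (ha i))
      have hstep := expTail_add_single_add_le hN hT0 i (ha i)
      rw [← e] at hstep
      have hexp : expNeg N a ≤ expNeg N ((insert i T).piecewise a 0) :=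
        ENNReal.ofReal_le_ofReal (Real.exp_le_exp.2 (neg_le_neg (hN.mono _ _ h0 hle)))
      refine le_trans ?_ ih
      rw [Finset.sum_insert hi, mul_add, ← add_assoc]
      gcongr
      refine le_trans (add_le_add le_rfl ?_) hstep
      rw [mul_left_comm]
      gcongr
  simpa using key Finset.univ

/-- Log-concavity of the tail on the segment from `0` to `α`: sublinearity of `N` gives the
Prékopa–Leindler hypothesis for the translated densities. -/
theorem expTail_rpow_mul_le (hN : IsMonotoneGauge N) {α : ι → ℝ} (hα : 0 ≤ α) {s : ℝ}
    (hs0 : 0 < s) (hs1 : s < 1) :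
    expTail N α ^ s * expTail N 0 ^ (1 - s) ≤ expTail N (s • α) := by
  have h1s : 0 < 1 - s := by linarith
  have hm : ∀ γ : ι → ℝ, Measurable fun y => expNeg N (γ + y) := fun γ =>
    hN.measurable_expNeg.comp (measurable_const_add γ)
  have anti : ∀ γ : ι → ℝ, 0 ≤ γ → ∀ x y, 0 ≤ x → x ≤ y →
      expNeg N (γ + y) ≤ expNeg N (γ + x) := fun γ hγ x y hx hxy =>
    ENNReal.ofReal_le_ofReal (Real.exp_le_exp.2 (neg_le_neg
      (hN.mono _ _ (add_nonneg hγ hx) (by gcongr))))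
  have h := lmarginal_prekopaLeindler hs0 hs1 (hm α) (hm 0) (hm (s • α)) (anti α hα)
    (anti 0 le_rfl) (fun x y hx hy => by
      simp only [expNeg]
      rw [ENNReal.ofReal_rpow_of_nonneg (Real.exp_nonneg _) hs0.le,
        ENNReal.ofReal_rpow_of_nonneg (Real.exp_nonneg _) h1s.le,
        ← ENNReal.ofReal_mul (by positivity), ← Real.exp_mul, ← Real.exp_mul, ← Real.exp_add]
      refine ENNReal.ofReal_le_ofReal (Real.exp_le_exp.2 ?_)
      have e : s • α + (s • x + (1 - s) • y) = s • (α + x) + (1 - s) • (0 + y) := by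
        rw [smul_add, zero_add, add_assoc]
      rw [e]
      have := hN.add_le (s • (α + x)) ((1 - s) • (0 + y))
      rw [hN.smul s hs0.le, hN.smul (1 - s) h1s.le] at this
      linarith) Finset.univ 0 0 le_rfl le_rfl
  simp only [lmarginal_univ] at h
  exact h

/-- A unit slab over a facet of infinite mass would itself have infinite mass. -/
theorem expFacet_ne_top (hN : IsMonotoneGauge N) (h : expTail N 0 ≠ ⊤) (i : ι) :
    expFacet N i ≠ ⊤ := by
  have h1 := expTail_add_le hN (a := Pi.single i 1) (Pi.single_nonneg.2 zero_le_one)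
  intro htop
  apply h
  have h2 : ∑ j, ENNReal.ofReal ((Pi.single i 1 : ι → ℝ) j) * expFacet N j = ⊤ := by
    rw [ENNReal.sum_eq_top]
    exact ⟨i, Finset.mem_univ i, by simp [htop]⟩
  rw [h2, ENNReal.mul_top (by simp [expNeg, Real.exp_pos])] at h1
  simpa using h1

/-- The tangent bound for a log-concave function. With `q` the normalised tail, log-concavity bounds
`q ^ s` by the normalised tail at `s • α`, and the slabs bound that by `1 - s σ exp (-s N α)`.
Taking logarithms, dividing by `s` and letting `s → 0` gives `log q ≤ -σ`. -/
theorem expTail_le (hN : IsMonotoneGauge N) (h0 : expTail N 0 ≠ 0) (ht : expTail N 0 ≠ ⊤)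
    {α : ι → ℝ} (hα : 0 ≤ α) :
    expTail N α ≤ expTail N 0 *
      ∏ i, ENNReal.ofReal (Real.exp (-((expFacet N i / expTail N 0).toReal * α i))) := by
  set V := expTail N 0
  set c : ι → ℝ := fun i => (expFacet N i / V).toReal with hc
  set σ := ∑ i, c i * α i with hσ
  have hV : 0 < V.toReal := ENNReal.toReal_pos h0 ht
  have hαt : expTail N α ≠ ⊤ := ne_top_of_le_ne_top ht (le_self_add.trans (expTail_add_le hN hα))
  set q := (expTail N α).toReal / V.toReal with hq
  have hq0 : 0 ≤ q := by positivity
  have bound : ∀ s : ℝ, 0 < s → s < 1 → q ^ s ≤ 1 - s * Real.exp (-(s * N α)) * σ := by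
    intro s hs0 hs1
    have h1s : 0 < 1 - s := by linarith
    have h1 := expTail_add_le hN (a := s • α) (smul_nonneg hs0.le hα)
    have h2 : expTail N α ^ s * V ^ (1 - s) + ENNReal.ofReal (Real.exp (-N (s • α))) *
        ∑ i, ENNReal.ofReal ((s • α) i) * expFacet N i ≤ V :=
      (add_le_add_left (expTail_rpow_mul_le hN hα hs0 hs1) _).trans h1
    have hst : ∑ i, ENNReal.ofReal ((s • α) i) * expFacet N i ≠ ⊤ :=
      ENNReal.sum_ne_top.2 fun i _ => ENNReal.mul_ne_top ENNReal.ofReal_ne_top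
        (expFacet_ne_top hN ht i)
    have h3 := ENNReal.toReal_mono ht h2
    rw [ENNReal.toReal_add (ENNReal.mul_ne_top (ENNReal.rpow_ne_top_of_nonneg hs0.le hαt)
      (ENNReal.rpow_ne_top_of_nonneg h1s.le ht)) (ENNReal.mul_ne_top ENNReal.ofReal_ne_top hst),
      ENNReal.toReal_mul, ENNReal.toReal_mul, ← ENNReal.toReal_rpow, ← ENNReal.toReal_rpow,
      ENNReal.toReal_sum (fun i _ => ENNReal.mul_ne_top ENNReal.ofReal_ne_top
        (expFacet_ne_top hN ht i)), ENNReal.toReal_ofReal (Real.exp_nonneg _),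
      hN.smul s hs0.le] at h3
    have h4 : ∑ i, (ENNReal.ofReal ((s • α) i) * expFacet N i).toReal = V.toReal * (s * σ) := by
      rw [hσ, Finset.mul_sum, Finset.mul_sum]
      refine Finset.sum_congr rfl fun i _ => ?_
      rw [ENNReal.toReal_mul, ENNReal.toReal_ofReal (smul_nonneg hs0.le hα i), hc]
      simp only [ENNReal.toReal_div, Pi.smul_apply, smul_eq_mul]
      field_simp
    have h5 : (expTail N α).toReal ^ s * V.toReal ^ (1 - s) = V.toReal * q ^ s := by
      rw [hq, Real.div_rpow ENNReal.toReal_nonneg hV.le, Real.rpow_sub hV, Real.rpow_one]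
      field_simp
    rw [h4, h5] at h3
    have h6 : V.toReal * (q ^ s + s * Real.exp (-(s * N α)) * σ) ≤ V.toReal * 1 := by
      linarith
    have := le_of_mul_le_mul_left h6 hV
    linarith
  have hqσ : q ≤ Real.exp (-σ) := by
    rcases hq0.eq_or_lt with h | hqpos
    · rw [← h]; exact Real.exp_nonneg _
    rw [← Real.log_le_iff_le_exp hqpos]
    have hlog : ∀ s : ℝ, 0 < s → s < 1 → Real.log q ≤ -(Real.exp (-(s * N α)) * σ) := by
      intro s hs0 hs1
      have h1 := (bound s hs0 hs1).trans (Real.one_sub_le_exp_neg _)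
      rw [← Real.log_le_iff_le_exp (Real.rpow_pos_of_pos hqpos s), Real.log_rpow hqpos] at h1
      have : s * Real.log q ≤ s * (-(Real.exp (-(s * N α)) * σ)) := by linarith
      exact le_of_mul_le_mul_left this hs0
    have hlim : Filter.Tendsto (fun s : ℝ => -(Real.exp (-(s * N α)) * σ)) (nhdsWithin 0 (Ioi 0))
        (nhds (-σ)) := by
      have : Continuous fun s : ℝ => -(Real.exp (-(s * N α)) * σ) := by fun_prop
      have h := (this.tendsto 0).mono_left (nhdsWithin_le_nhds (s := Ioi 0))
      simpa using h
    refine ge_of_tendsto hlim ?_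
    filter_upwards [Ioo_mem_nhdsGT (zero_lt_one' ℝ)] with s hs using hlog s hs.1 hs.2
  have hprod : ∏ i, ENNReal.ofReal (Real.exp (-(c i * α i))) = ENNReal.ofReal (Real.exp (-σ)) := by
    rw [← ENNReal.ofReal_prod_of_nonneg (fun _ _ => Real.exp_nonneg _), ← Real.exp_sum,
      Finset.sum_neg_distrib]
  rw [hprod, ← ENNReal.ofReal_toReal hαt, ← ENNReal.ofReal_toReal ht,
    ← ENNReal.ofReal_mul ENNReal.toReal_nonneg]
  refine ENNReal.ofReal_le_ofReal ?_
  rw [hq, div_le_iff₀ hV] at hqσ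
  linarith

end Tail

/-! ### Gamma integrals and measures with power distribution functions. -/

theorem lintegral_pow_mul_exp_neg_mul (k : ℕ) {c : ℝ} (hc : 0 < c) :
    ∫⁻ t in Ioi (0 : ℝ), ENNReal.ofReal (t ^ k * Real.exp (-(c * t))) =
      ENNReal.ofReal (k.factorial / c ^ (k + 1)) := by
  have h := Real.integral_rpow_mul_exp_neg_mul_Ioi (a := (k : ℝ) + 1) (r := c) (by positivity) hc
  have h2 : ∫ t in Ioi (0 : ℝ), t ^ k * Real.exp (-(c * t)) = k.factorial / c ^ (k + 1) := by
    rw [Real.Gamma_nat_eq_factorial] at h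
    simp only [add_sub_cancel_right, Real.rpow_natCast] at h
    rw [h, ← Nat.cast_succ, Real.rpow_natCast, one_div, inv_pow, Nat.succ_eq_add_one]
    field_simp
  have hi : IntegrableOn (fun t : ℝ => t ^ k * Real.exp (-(c * t))) (Ioi 0) := by
    -- A non-integrable function has Bochner integral `0`, whereas the value found is positive.
    by_contra hni
    rw [integral_undef hni] at h2
    have : 0 < (k.factorial : ℝ) / c ^ (k + 1) := by positivity
    linarith
  rw [← h2, ofReal_integral_eq_lintegral_ofReal hi]
  exact (ae_restrict_iff' measurableSet_Ioi).2 (ae_of_all _ fun t (ht : 0 < t) => by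
    simp only [Pi.zero_apply]; positivity)

theorem lintegral_Ici_exp_neg {a : ℝ} (ha : 0 ≤ a) :
    ∫⁻ t in Ioi (0 : ℝ) ∩ Ici a, ENNReal.ofReal (Real.exp (-t)) = ENNReal.ofReal (Real.exp (-a)) := by
  have e : (Ioi (0 : ℝ) ∩ Ici a : Set ℝ) =ᵐ[volume] Ioi a := by
    have h1 : (Ici a : Set ℝ) =ᵐ[volume] Ioi a := Ioi_ae_eq_Ici.symm
    have h2 := (ae_eq_refl (Ioi (0 : ℝ))).inter h1
    rwa [Ioi_inter_Ioi, sup_eq_right.2 ha] at h2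
  rw [setLIntegral_congr e, ← integral_exp_neg_Ioi a,
    ofReal_integral_eq_lintegral_ofReal (integrableOn_exp_neg_Ioi a)]
  exact ae_of_all _ fun t => Real.exp_nonneg _

/-- The measure on `[0, ∞)` with distribution function `x ↦ x ^ m`. -/
noncomputable def powMeasure (m : ℕ) : Measure ℝ :=
  -- For `m = 0` the distribution function is `1` from the origin on, so the measure is an atom.
  if m = 0 then Measure.dirac 0 else
    (volume.restrict (Ioi 0)).withDensity fun t => ENNReal.ofReal (m * t ^ (m - 1))

instance (m : ℕ) : SigmaFinite (powMeasure m) := by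
  unfold powMeasure
  split_ifs
  · infer_instance
  · exact SigmaFinite.withDensity_of_ne_top (ae_of_all _ fun _ => ENNReal.ofReal_ne_top)

theorem powMeasure_ae_nonneg (m : ℕ) : ∀ᵐ t ∂powMeasure m, 0 ≤ t := by
  unfold powMeasure
  split_ifs
  · rw [ae_dirac_iff measurableSet_Ici]
  · refine (withDensity_absolutelyContinuous _ _).ae_le ?_
    filter_upwards [self_mem_ae_restrict (μ := volume) (measurableSet_Ioi (a := (0 : ℝ)))] with t ht
      using le_of_lt ht

theorem powMeasure_Iic (m : ℕ) {x : ℝ} (hx : 0 ≤ x) :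
    powMeasure m (Iic x) = ENNReal.ofReal (x ^ m) := by
  unfold powMeasure
  split_ifs with h
  · simp [h, hx]
  · rw [withDensity_apply _ measurableSet_Iic, Measure.restrict_restrict measurableSet_Iic,
      inter_comm, Ioi_inter_Iic, ← ofReal_integral_eq_lintegral_ofReal,
      ← intervalIntegral.integral_of_le hx]
    · congr 1
      rw [intervalIntegral.integral_const_mul, integral_pow, Nat.sub_add_cancel (Nat.pos_of_ne_zero h)]
      have h1 : ((m - 1 : ℕ) : ℝ) + 1 = m := by
        exact_mod_cast Nat.sub_add_cancel (Nat.pos_of_ne_zero h)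
      have h2 : (m : ℝ) ≠ 0 := by exact_mod_cast h
      rw [h1, zero_pow h, sub_zero]
      field_simp
    · exact (Continuous.integrableOn_Icc (by fun_prop)).mono_set Ioc_subset_Icc_self
    · exact (ae_restrict_iff' measurableSet_Ioc).2 (ae_of_all _ fun t ht => by
        have := ht.1.le
        simp only [Pi.zero_apply]; positivity)

theorem lintegral_powMeasure_exp (m : ℕ) {c : ℝ} (hc : 0 < c) :
    ∫⁻ t, ENNReal.ofReal (Real.exp (-(c * t))) ∂powMeasure m =
      ENNReal.ofReal (m.factorial / c ^ m) := by
  have hm : Measurable fun t : ℝ => ENNReal.ofReal (Real.exp (-(c * t))) := by fun_prop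
  unfold powMeasure
  split_ifs with h
  · rw [lintegral_dirac' _ hm]
    simp [h]
  · rw [lintegral_withDensity_eq_lintegral_mul _ (by fun_prop) hm]
    have e : m - 1 + 1 = m := Nat.sub_add_cancel (Nat.pos_of_ne_zero h)
    have : ∀ t : ℝ, 0 < t → ENNReal.ofReal (m * t ^ (m - 1)) * ENNReal.ofReal (Real.exp (-(c * t))) =
        ENNReal.ofReal m * ENNReal.ofReal (t ^ (m - 1) * Real.exp (-(c * t))) := by
      intro t ht
      rw [← ENNReal.ofReal_mul (by positivity), ← ENNReal.ofReal_mul (by positivity), mul_assoc]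
    simp only [Pi.mul_apply]
    rw [setLIntegral_congr_fun measurableSet_Ioi fun t ht => this t ht,
      lintegral_const_mul _ (by fun_prop), lintegral_pow_mul_exp_neg_mul _ hc, e,
      ← ENNReal.ofReal_mul (by positivity), ← Nat.mul_factorial_pred h]
    push_cast
    congr 1
    ring

/-! ### Product integrals and reduction of even functions to the orthant. -/

section Product

variable {ι : Type*} [Fintype ι]

theorem pi_halfLine : Measure.pi (halfLine (ι := ι)) = volume.restrict (Ici 0) := by
  rw [← Measure.restrict_pi_pi (fun _ : ι => (volume : Measure ℝ)) (fun _ => Ici 0)]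
  congr 1
  exact pi_univ_Ici _

variable [DecidableEq ι]

theorem lintegral_pi_prod {μ : ι → Measure ℝ} [∀ i, SigmaFinite (μ i)] {g : ι → ℝ → ℝ≥0∞}
    (hg : ∀ i, Measurable (g i)) :
    ∫⁻ x, ∏ i, g i (x i) ∂Measure.pi μ = ∏ i, ∫⁻ t, g i t ∂μ i := by
  have hm : ∀ T : Finset ι, Measurable fun x : ι → ℝ => ∏ i ∈ T, g i (x i) := fun T =>
    Finset.measurable_prod _ fun i _ => (hg i).comp (measurable_pi_apply i)
  have key : ∀ T : Finset ι, ∀ x, (∫⋯∫⁻_T, (fun x => ∏ i ∈ T, g i (x i)) ∂μ) x =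
      ∏ i ∈ T, ∫⁻ t, g i t ∂μ i := by
    intro T
    induction T using Finset.induction with
    | empty => simp
    | insert j T hj ih =>
      intro x
      have hmT : ∀ x : ι → ℝ, Measurable fun z : T → ℝ =>
          ∏ i ∈ T, g i (Function.updateFinset x T z i) := fun x => (hm T).comp measurable_updateFinset
      rw [lmarginal_insert' _ (hm _) hj, Finset.prod_insert hj, ← ih x, lmarginal, lmarginal,
        ← lintegral_const_mul _ (hmT x)]
      refine lintegral_congr fun z => ?_
      rw [← lintegral_mul_const _ (hg j)]
      refine lintegral_congr fun t => ?_
      rw [Finset.prod_insert hj]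
      simp only [Function.update_self]
      congr 1
      refine Finset.prod_congr rfl fun i hi => ?_
      rw [Function.update_of_ne (by rintro rfl; exact hj hi)]
  rw [lintegral_eq_lmarginal_univ (0 : ι → ℝ), key Finset.univ 0]

theorem lintegral_eq_two_mul_of_even {g : ℝ → ℝ≥0∞} (h : ∀ t, g (-t) = g t) :
    ∫⁻ t, g t = 2 * ∫⁻ t in Ici 0, g t := by
  have h1 : ∫⁻ t in Iio 0, g t = ∫⁻ t in Ici 0, g t := by
    rw [← lintegral_indicator measurableSet_Iio, ← lintegral_neg_eq_self,
      setLIntegral_congr Ioi_ae_eq_Ici.symm, ← lintegral_indicator measurableSet_Ioi]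
    refine lintegral_congr fun t => ?_
    simp [indicator, h]
  rw [← lintegral_add_compl g (measurableSet_Ici (a := (0 : ℝ))), compl_Ici, h1, two_mul]

/-- Integral of a function even in every coordinate, in terms of the positive orthant. -/
theorem lintegral_eq_two_pow_mul_of_even {G : (ι → ℝ) → ℝ≥0∞} (hG : Measurable G)
    (he : ∀ x i, G (Function.update x i (-x i)) = G x) :
    ∫⁻ x, G x = 2 ^ Fintype.card ι * ∫⁻ x, G x ∂Measure.pi halfLine := by
  have he' : ∀ i x t, G (Function.update x i (-t)) = G (Function.update x i t) := by
    intro i x t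
    have := he (Function.update x i t) i
    simpa using this
  have key : ∀ T : Finset ι, ∀ x, (∫⋯∫⁻_T, G ∂(fun _ => (volume : Measure ℝ))) x =
      2 ^ T.card * (∫⋯∫⁻_T, G ∂halfLine) x := by
    intro T
    induction T using Finset.induction with
    | empty => simp
    | insert j T hj ih =>
      intro x
      rw [lmarginal_insert _ hG hj, lmarginal_insert _ hG hj, Finset.card_insert_of_notMem hj]
      simp_rw [ih]
      have hm : Measurable fun t => (∫⋯∫⁻_T, G ∂halfLine) (Function.update x j t) :=
        (hG.lmarginal _).comp (measurable_update _)
      rw [lintegral_const_mul _ hm, lintegral_eq_two_mul_of_even, pow_succ, mul_assoc]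
      intro t
      rw [lmarginal_update_of_notMem hG hj, lmarginal_update_of_notMem hG hj]
      have : (G ∘ fun y => Function.update y j (-t)) = (G ∘ fun y => Function.update y j t) :=
        funext fun y => he' j y t
      rw [this]
  have := key Finset.univ 0
  simp only [lmarginal_univ, Finset.card_univ] at this
  exact this

end Product

/-! ### Monomial moments of `exp (-N)`. -/

section Moments

/-- Radial integration with profile `exp (-t)`, whose Gamma integral is `(n + d)!`. The indicator of
the orthant is homogeneous of degree `0` and is absorbed into `F`. -/
theorem lintegral_homogeneous_mul_expNeg {ι : Type*} [Fintype ι] [DecidableEq ι]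
    {N : (ι → ℝ) → ℝ} {F : (ι → ℝ) → ℝ≥0∞} {d : ℕ}
    (hF : Measurable F) (hNm : Measurable N) (hN0 : ∀ x, 0 ≤ N x)
    (hFh : ∀ t : ℝ, 0 < t → ∀ x, F (t • x) = ENNReal.ofReal (t ^ d) * F x)
    (hNh : ∀ t : ℝ, 0 < t → ∀ x, N (t • x) = t * N x) :
    ∫⁻ x, F x * expNeg N x ∂Measure.pi halfLine =
      (Fintype.card ι + d).factorial * ∫⁻ x in {x | N x ≤ 1}, F x ∂Measure.pi halfLine := by
  have h := lintegral_homogeneous_mul (μ := (volume : Measure (ι → ℝ)))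
    (F := (Ici 0).indicator F) (φ := fun t => ENNReal.ofReal (Real.exp (-t))) (d := d)
    (hF.indicator measurableSet_Ici) hNm (by fun_prop) (fun t ht x => by
      have : t • x ∈ Ici (0 : ι → ℝ) ↔ x ∈ Ici 0 := by
        simp only [mem_Ici]
        exact smul_nonneg_iff_nonneg_of_pos_left ht
      by_cases hx : x ∈ Ici (0 : ι → ℝ)
      · rw [indicator_of_mem (this.2 hx), indicator_of_mem hx, hFh t ht]
      · rw [indicator_of_notMem (fun h => hx (this.1 h)), indicator_of_notMem hx, mul_zero]) hNh
  simp_rw [lintegral_Ici_exp_neg (hN0 _)] at h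
  have hfac : ∫⁻ t in Ioi (0 : ℝ), ENNReal.ofReal (Real.exp (-t)) *
      ENNReal.ofReal (t ^ (Module.finrank ℝ (ι → ℝ) + d)) = (Fintype.card ι + d).factorial := by
    have := lintegral_pow_mul_exp_neg_mul (Fintype.card ι + d) one_pos
    rw [one_pow, div_one, ENNReal.ofReal_natCast] at this
    rw [← this, Module.finrank_fintype_fun_eq_card]
    refine lintegral_congr fun t => ?_
    rw [one_mul, mul_comm, ENNReal.ofReal_mul' (Real.exp_nonneg _)]
  rw [hfac] at h
  have e : ∀ x, (Ici 0).indicator F x * ENNReal.ofReal (Real.exp (-N x)) =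
      (Ici 0).indicator (fun x => F x * expNeg N x) x := fun x =>
    (indicator_mul_left _ F (expNeg N)).symm
  simp_rw [e] at h
  rw [lintegral_indicator measurableSet_Ici, lintegral_indicator measurableSet_Ici,
    Measure.restrict_restrict measurableSet_Ici, inter_comm,
    ← Measure.restrict_restrict (measurableSet_le hNm measurable_const)] at h
  rw [pi_halfLine, h]

variable {ι : Type*} [Fintype ι] {N : (ι → ℝ) → ℝ}

theorem setLIntegral_Ici_expNeg {α : ι → ℝ} (hα : 0 ≤ α) :
    ∫⁻ x in Ici α, expNeg N x ∂Measure.pi halfLine = expTail N α := by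
  rw [expTail, pi_halfLine, Measure.restrict_restrict measurableSet_Ici,
    inter_eq_left.2 (Ici_subset_Ici.2 hα), ← lintegral_indicator measurableSet_Ici,
    ← lintegral_indicator measurableSet_Ici,
    ← lintegral_add_left_eq_self (fun x => (Ici α).indicator (expNeg N) x) α]
  refine lintegral_congr fun x => ?_
  have e : α + x ∈ Ici α ↔ x ∈ Ici 0 := by
    simp only [mem_Ici]
    exact le_add_iff_nonneg_right α
  by_cases hx : x ∈ Ici 0
  · rw [indicator_of_mem (e.2 hx), indicator_of_mem hx]
  · rw [indicator_of_notMem (fun h => hx (e.1 h)), indicator_of_notMem hx]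

variable [DecidableEq ι]

/-- On the orthant the monomial at `x` is the `η`-mass of `{t | t ≤ x}`, so by Fubini the moment is
the `η`-integral of the tail. The exponential tail bound then factorises over coordinates. -/
theorem lintegral_monomial_mul_expNeg_le (hN : IsMonotoneGauge N) (h0 : expTail N 0 ≠ 0)
    (ht : expTail N 0 ≠ ⊤) (hS : ∀ i, expFacet N i ≠ 0) (m : ι → ℕ) :
    ∫⁻ x, (∏ i, ENNReal.ofReal (x i ^ m i)) * expNeg N x ∂Measure.pi halfLine ≤
      expTail N 0 * ∏ i, ENNReal.ofReal
        ((m i).factorial / (expFacet N i / expTail N 0).toReal ^ m i) := by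
  set η : Measure (ι → ℝ) := Measure.pi fun i => powMeasure (m i) with hη
  have hle : MeasurableSet {p : (ι → ℝ) × (ι → ℝ) | p.2 ≤ p.1} :=
    measurableSet_le measurable_snd measurable_fst
  have e1 : ∫⁻ x, (∏ i, ENNReal.ofReal (x i ^ m i)) * expNeg N x ∂Measure.pi halfLine =
      ∫⁻ x, ∫⁻ t, {p : (ι → ℝ) × (ι → ℝ) | p.2 ≤ p.1}.indicator (fun p => expNeg N p.1) (x, t) ∂η
        ∂Measure.pi halfLine := by
    rw [pi_halfLine]
    refine setLIntegral_congr_fun measurableSet_Ici fun x hx => ?_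
    have e : ∀ t, {p : (ι → ℝ) × (ι → ℝ) | p.2 ≤ p.1}.indicator (fun p => expNeg N p.1) (x, t) =
        (Iic x).indicator (fun _ => expNeg N x) t := fun t => rfl
    simp_rw [e]
    rw [lintegral_indicator measurableSet_Iic, setLIntegral_const, mul_comm, hη, ← pi_univ_Iic,
      Measure.pi_pi]
    congr 1
    exact Finset.prod_congr rfl fun i _ => (powMeasure_Iic _ (hx i)).symm
  have hsw : AEMeasurable (Function.uncurry fun x t =>
      {p : (ι → ℝ) × (ι → ℝ) | p.2 ≤ p.1}.indicator (fun p => expNeg N p.1) (x, t))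
      ((Measure.pi halfLine).prod η) :=
    ((hN.measurable_expNeg.comp measurable_fst).indicator hle).aemeasurable
  rw [e1, lintegral_lintegral_swap hsw]
  have hc : ∀ i, 0 < (expFacet N i / expTail N 0).toReal := fun i =>
    ENNReal.toReal_pos (ENNReal.div_ne_zero.2 ⟨hS i, ht⟩)
      (ENNReal.div_ne_top (expFacet_ne_top hN ht i) h0)
  calc _ ≤ ∫⁻ t, expTail N 0 *
        ∏ i, ENNReal.ofReal (Real.exp (-((expFacet N i / expTail N 0).toReal * t i))) ∂η := by
        refine lintegral_mono_ae ?_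
        have hae : ∀ᵐ t ∂η, ∀ i, 0 ≤ t i := ae_all_iff.2 fun i =>
          Measure.tendsto_eval_ae_ae.eventually (powMeasure_ae_nonneg (m i))
        filter_upwards [hae] with t ht0
        have e : ∀ x, {p : (ι → ℝ) × (ι → ℝ) | p.2 ≤ p.1}.indicator (fun p => expNeg N p.1) (x, t) =
            (Ici t).indicator (expNeg N) x := fun x => rfl
        simp_rw [e]
        rw [lintegral_indicator measurableSet_Ici, setLIntegral_Ici_expNeg ht0]
        exact expTail_le hN h0 ht ht0
    _ = _ := by
        rw [lintegral_const_mul _ (Finset.measurable_prod _ fun i _ => by fun_prop), hη,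
          lintegral_pi_prod (g := fun i t => ENNReal.ofReal
            (Real.exp (-((expFacet N i / expTail N 0).toReal * t)))) fun i => by fun_prop]
        congr 1
        exact Finset.prod_congr rfl fun i _ => lintegral_powMeasure_exp _ (hc i)

end Moments

/-! ### Volumes of facets and sections of the orthant part of the ball. -/

section Facet

variable {ι : Type*} {N : (ι → ℝ) → ℝ}

/-- The indicator function of the unit ball of `N`. -/
noncomputable def unitBallIndicator (N : (ι → ℝ) → ℝ) : (ι → ℝ) → ℝ≥0∞ :=
  {x | N x ≤ 1}.indicator 1

theorem IsMonotoneGauge.unitBallIndicator_anti (hN : IsMonotoneGauge N) {x y : ι → ℝ} (hx : 0 ≤ x)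
    (hxy : x ≤ y) : unitBallIndicator N y ≤ unitBallIndicator N x := by
  by_cases h : N y ≤ 1
  · have := (hN.mono x y hx hxy).trans h
    simp [unitBallIndicator, h, this]
  · simp [unitBallIndicator, h]

variable [Fintype ι]

/-- The volume of the part of the unit ball of `N` in the positive orthant. -/
noncomputable def orthantVol (N : (ι → ℝ) → ℝ) : ℝ≥0∞ := Measure.pi halfLine {x | N x ≤ 1}

theorem IsMonotoneGauge.measurableSet_unitBall (hN : IsMonotoneGauge N) :
    MeasurableSet {x | N x ≤ 1} :=
  measurableSet_le hN.cont.measurable measurable_const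

theorem IsMonotoneGauge.measurable_unitBallIndicator (hN : IsMonotoneGauge N) :
    Measurable (unitBallIndicator N) :=
  measurable_one.indicator hN.measurableSet_unitBall

theorem lintegral_unitBallIndicator (hN : IsMonotoneGauge N) :
    ∫⁻ x, unitBallIndicator N x ∂Measure.pi halfLine = orthantVol N := by
  rw [unitBallIndicator, lintegral_indicator_one hN.measurableSet_unitBall, orthantVol]

variable [DecidableEq ι]

/-- The volume of the facet `x i = 0` of the part of the unit ball of `N` in the positive
orthant. -/
noncomputable def facetVol (N : (ι → ℝ) → ℝ) (i : ι) : ℝ≥0∞ :=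
  (∫⋯∫⁻_{i}ᶜ, unitBallIndicator N ∂halfLine) 0

theorem expTail_zero_eq (hN : IsMonotoneGauge N) :
    expTail N 0 = (Fintype.card ι).factorial * orthantVol N := by
  have h := lintegral_homogeneous_mul_expNeg (F := fun _ => 1) (d := 0) measurable_const
    hN.cont.measurable hN.nonneg (by simp) (fun t ht => hN.smul t ht.le)
  simpa [expTail, orthantVol] using h

theorem expFacet_eq (hN : IsMonotoneGauge N) (i : ι) :
    expFacet N i = (Fintype.card ι - 1).factorial * facetVol N i := by
  have hu : Measurable (Function.updateFinset (0 : ι → ℝ) ({i}ᶜ : Finset ι)) :=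
    measurable_updateFinset
  have h := lintegral_homogeneous_mul_expNeg (ι := ({i}ᶜ : Finset ι))
    (N := fun z => N (Function.updateFinset 0 {i}ᶜ z)) (F := fun _ => 1) (d := 0) measurable_const
    (hN.cont.measurable.comp hu) (fun _ => hN.nonneg _) (by simp) (fun t ht z => by
      rw [← hN.smul t ht.le]
      congr 1
      ext j
      by_cases hj : j = i <;> simp [Function.updateFinset, hj])
  have hc : Fintype.card ({i}ᶜ : Finset ι) = Fintype.card ι - 1 := by
    rw [Fintype.card_coe, Finset.card_compl, Finset.card_singleton]
  rw [hc] at h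
  simp only [one_mul, add_zero, lintegral_const, Measure.restrict_apply_univ] at h
  have hf : facetVol N i = Measure.pi halfLine
      {z : ({i}ᶜ : Finset ι) → ℝ | N (Function.updateFinset 0 {i}ᶜ z) ≤ 1} := by
    exact lintegral_indicator_one
      (measurableSet_le (hN.cont.measurable.comp hu) measurable_const)
  rw [hf]
  exact h

/-- Loomis–Whitney: by monotonicity of `N`, setting a coordinate to `0` stays in the ball, so the
coordinate projections are the facets. -/
theorem orthantVol_pow_le (hN : IsMonotoneGauge N) [Nonempty ι] :
    orthantVol N ^ (Fintype.card ι - 1) ≤ ∏ i, facetVol N i := by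
  have hm : ∀ i : ι, Measurable fun x : ι → ℝ => Function.update x i 0 := fun i =>
    measurable_update_left
  rcases Nat.lt_or_ge 1 (Fintype.card ι) with hc | hc
  · have h := lintegral_pow_le_prod_lmarginal (μ := halfLine)
      (f := fun i => unitBallIndicator N ∘ (Function.update · i 0))
      (g := (Ici 0).indicator (unitBallIndicator N))
      (fun i => hN.measurable_unitBallIndicator.comp (hm i)) (fun i x t => by simp)
      (fun i x => by
        simp only [unitBallIndicator, Function.comp_apply]
        by_cases hx : Function.update x i 0 ∈ {x | N x ≤ 1}
        · right; rw [indicator_of_mem hx, Pi.one_apply]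
        · left; rw [indicator_of_notMem hx])
      (fun x => by
        by_cases hx : x ∈ Ici (0 : ι → ℝ)
        · rw [indicator_of_mem hx]
          by_cases hx1 : N x ≤ 1
          · refine le_of_eq_of_le ?_ (Finset.prod_le_prod' (f := fun _ => 1) fun i _ => ?_)
            · simp [unitBallIndicator, hx1]
            · have h0 : (0 : ι → ℝ) ≤ Function.update x i 0 := by
                intro j
                by_cases hj : j = i
                · subst hj; simp
                · simpa [hj] using hx j
              have h1 : Function.update x i 0 ≤ x := by
                rw [update_le_iff]
                exact ⟨hx i, fun _ _ => le_rfl⟩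
              have := (hN.mono _ _ h0 h1).trans hx1
              simp [unitBallIndicator, this]
          · simp [unitBallIndicator, hx1]
        · rw [indicator_of_notMem hx]
          exact zero_le) hc 0
    have e1 : ∫⁻ x, (Ici 0).indicator (unitBallIndicator N) x ∂Measure.pi halfLine =
        orthantVol N := by
      rw [← lintegral_unitBallIndicator hN, pi_halfLine, lintegral_indicator measurableSet_Ici,
        Measure.restrict_restrict measurableSet_Ici, inter_self]
    rw [e1] at h
    refine h.trans (Finset.prod_le_prod' fun i _ => le_of_eq ?_)
    rw [← lmarginal_update_of_notMem hN.measurable_unitBallIndicator (by simp), facetVol]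
    congr 1
    simp
  -- In dimension one the facet is the origin, of volume `1` for the empty product measure.
  · have hc1 : Fintype.card ι = 1 := le_antisymm hc Fintype.card_pos
    rw [hc1, Nat.sub_self, pow_zero]
    obtain ⟨i, hi⟩ := Fintype.card_eq_one_iff.1 hc1
    have : Subsingleton ι := ⟨fun a b => (hi a).trans (hi b).symm⟩
    refine Finset.one_le_prod' fun j _ => ?_
    have he : ({j}ᶜ : Finset ι) = ∅ := by
      ext a; simp [Subsingleton.elim a j]
    have h0 : N 0 = 0 := by simpa using hN.smul 0 le_rfl 0
    rw [facetVol, he, lmarginal_empty, unitBallIndicator]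
    simp [h0]

/-- The section of the positive part of the unit ball at height `t`. -/
noncomputable def sectionVol (N : (ι → ℝ) → ℝ) (i : ι) (t : ℝ) : ℝ≥0∞ :=
  (∫⋯∫⁻_{i}ᶜ, unitBallIndicator N ∂halfLine) (Function.update 0 i t)

theorem measurable_sectionVol (hN : IsMonotoneGauge N) (i : ι) : Measurable (sectionVol N i) :=
  (hN.measurable_unitBallIndicator.lmarginal _).comp (measurable_update _)

theorem lintegral_sectionVol (hN : IsMonotoneGauge N) (i : ι) :
    ∫⁻ t in Ici 0, sectionVol N i t = orthantVol N := by
  rw [← lintegral_unitBallIndicator hN,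
    lintegral_pi_eq_lintegral_lmarginal hN.measurable_unitBallIndicator i]
  rfl

theorem sectionVol_le (hN : IsMonotoneGauge N) (i : ι) {t : ℝ} (ht : 0 ≤ t) :
    sectionVol N i t ≤ facetVol N i := by
  refine lmarginal_halfLine_antitone hN.measurable_unitBallIndicator
    (fun x y hx hxy => hN.unitBallIndicator_anti hx hxy) _ _ _ le_rfl ?_
  intro j
  by_cases hj : j = i
  · subst hj; simpa using ht
  · simp [hj]

theorem lintegral_sq_eq (hN : IsMonotoneGauge N) (i : ι) :
    ∫⁻ x in {x | N x ≤ 1}, ENNReal.ofReal (x i ^ 2) ∂Measure.pi halfLine =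
      ∫⁻ t in Ici 0, ENNReal.ofReal (t ^ 2) * sectionVol N i t := by
  have hm : Measurable fun x : ι → ℝ => ENNReal.ofReal (x i ^ 2) := by fun_prop
  have e : ∀ x, {x | N x ≤ 1}.indicator (fun x => ENNReal.ofReal (x i ^ 2)) x =
      ENNReal.ofReal (x i ^ 2) * unitBallIndicator N x := by
    intro x
    by_cases hx : N x ≤ 1 <;> simp [unitBallIndicator, hx]
  rw [← lintegral_indicator hN.measurableSet_unitBall]
  simp_rw [e]
  have hmm : Measurable fun x => ENNReal.ofReal (x i ^ 2) * unitBallIndicator N x :=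
    hm.mul hN.measurable_unitBallIndicator
  rw [lintegral_pi_eq_lintegral_lmarginal hmm i]
  refine lintegral_congr fun t => ?_
  rw [sectionVol, lmarginal, lmarginal, ← lintegral_const_mul]
  · refine lintegral_congr fun z => ?_
    simp [Function.updateFinset]
  · exact hN.measurable_unitBallIndicator.comp measurable_updateFinset

/-- Integrate `T² ≤ t² + (T² - t²)₊` against the section volumes, bounding these by the facet in the
last term, where `∫₀ᵀ (T² - t²) dt = 2 T³ / 3`. The result is a lower bound for the second moment.
-/
theorem sq_mul_orthantVol_le (hN : IsMonotoneGauge N) (i : ι) {T : ℝ} (hT : 0 ≤ T) :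
    ENNReal.ofReal (T ^ 2) * orthantVol N ≤
      ∫⁻ x in {x | N x ≤ 1}, ENNReal.ofReal (x i ^ 2) ∂Measure.pi halfLine +
        ENNReal.ofReal (2 / 3 * T ^ 3) * facetVol N i := by
  have hsm := measurable_sectionVol hN i
  have e1 : ∫⁻ t in Ici 0, (Iic T).indicator (fun t => ENNReal.ofReal (T ^ 2 - t ^ 2)) t =
      ENNReal.ofReal (2 / 3 * T ^ 3) := by
    rw [lintegral_indicator measurableSet_Iic, Measure.restrict_restrict measurableSet_Iic,
      Iic_inter_Ici, setLIntegral_congr Ioc_ae_eq_Icc.symm, ← ofReal_integral_eq_lintegral_ofReal,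
      ← intervalIntegral.integral_of_le hT]
    · congr 1
      rw [intervalIntegral.integral_sub (by simp) (by simp), integral_pow]
      simp
      ring
    · exact (Continuous.integrableOn_Icc (by fun_prop)).mono_set Ioc_subset_Icc_self
    · exact (ae_restrict_iff' measurableSet_Ioc).2 (ae_of_all _ fun t ht => by
        have := pow_le_pow_left₀ ht.1.le ht.2 2
        simp only [Pi.zero_apply]; linarith)
  rw [lintegral_sq_eq hN, ← lintegral_sectionVol hN i, ← e1, ← lintegral_const_mul _ hsm,
    ← lintegral_mul_const _ ((by fun_prop : Measurable fun t : ℝ =>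
      ENNReal.ofReal (T ^ 2 - t ^ 2)).indicator measurableSet_Iic),
    ← lintegral_add_left (by fun_prop)]
  refine setLIntegral_mono' measurableSet_Ici fun t ht => ?_
  by_cases htT : t ≤ T
  · rw [indicator_of_mem (show t ∈ Iic T from htT)]
    have h1 : ENNReal.ofReal (T ^ 2) = ENNReal.ofReal (t ^ 2) + ENNReal.ofReal (T ^ 2 - t ^ 2) := by
      rw [← ENNReal.ofReal_add (by positivity)
        (sub_nonneg.2 (pow_le_pow_left₀ ht htT 2))]
      congr 1
      ring
    rw [h1, add_mul]
    gcongr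
    exact sectionVol_le hN i ht
  · refine le_trans ?_ le_self_add
    gcongr
    exact (not_le.1 htT).le

end Facet

/-! ### Facet ratios in isotropic position. -/

section Isotropic

variable {ι : Type*} [Fintype ι] [DecidableEq ι] {N : (ι → ℝ) → ℝ}

/-- The ratio of the volume of the `i`-th facet to the volume of the positive part of the unit
ball. -/
noncomputable def facetRatio (N : (ι → ℝ) → ℝ) (i : ι) : ℝ := (facetVol N i / orthantVol N).toReal

theorem facetVol_ne_zero (hN : IsMonotoneGauge N) (h0 : orthantVol N ≠ 0) (i : ι) :
    facetVol N i ≠ 0 := by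
  intro h
  apply h0
  rw [← lintegral_sectionVol hN i]
  refine (setLIntegral_congr_fun (g := fun _ => 0) measurableSet_Ici fun t ht => ?_).trans (by simp)
  exact le_antisymm ((sectionVol_le hN i ht).trans h.le) zero_le

theorem facetVol_ne_top (hN : IsMonotoneGauge N) (ht : orthantVol N ≠ ⊤) (i : ι) :
    facetVol N i ≠ ⊤ := by
  have h : expTail N 0 ≠ ⊤ := by
    rw [expTail_zero_eq hN]
    exact ENNReal.mul_ne_top (ENNReal.natCast_ne_top _) ht
  have h2 := expFacet_ne_top hN h i
  rw [expFacet_eq hN] at h2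
  intro h3
  rw [h3, ENNReal.mul_top (by exact_mod_cast Nat.factorial_ne_zero _)] at h2
  exact h2 rfl

theorem facetRatio_pos (hN : IsMonotoneGauge N) (h0 : orthantVol N ≠ 0) (ht : orthantVol N ≠ ⊤)
    (i : ι) : 0 < facetRatio N i :=
  ENNReal.toReal_pos (ENNReal.div_ne_zero.2 ⟨facetVol_ne_zero hN h0 i, ht⟩)
    (ENNReal.div_ne_top (facetVol_ne_top hN ht i) h0)

/-- The factor `1 / n` is `(n - 1)! / n!`: a facet has one dimension less. -/
theorem expFacet_div_expTail (hN : IsMonotoneGauge N) (i : ι) :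
    (expFacet N i / expTail N 0).toReal = facetRatio N i / Fintype.card ι := by
  have : Nonempty ι := ⟨i⟩
  have hc : (Fintype.card ι : ℝ) ≠ 0 := by exact_mod_cast Fintype.card_ne_zero
  rw [expFacet_eq hN, expTail_zero_eq hN, facetRatio,
    ← Nat.mul_factorial_pred (Fintype.card_ne_zero (α := ι))]
  simp only [ENNReal.toReal_div, ENNReal.toReal_mul, ENNReal.toReal_natCast, Nat.cast_mul]
  field_simp

theorem factorial_mul_lintegral_monomial_le (hN : IsMonotoneGauge N) (h0 : orthantVol N ≠ 0)
    (ht : orthantVol N ≠ ⊤) (m : ι → ℕ) :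
    (Fintype.card ι + ∑ i, m i).factorial *
        ∫⁻ x in {x | N x ≤ 1}, ∏ i, ENNReal.ofReal (x i ^ m i) ∂Measure.pi halfLine ≤
      (Fintype.card ι).factorial * orthantVol N *
        ∏ i, ENNReal.ofReal ((m i).factorial * (Fintype.card ι / facetRatio N i) ^ m i) := by
  have hF : Measurable fun x : ι → ℝ => ∏ i, ENNReal.ofReal (x i ^ m i) :=
    Finset.measurable_prod _ fun i _ => by fun_prop
  rw [← lintegral_homogeneous_mul_expNeg hF hN.cont.measurable hN.nonneg (fun t htt x => by
    rw [← Finset.prod_pow_eq_pow_sum, ENNReal.ofReal_prod_of_nonneg fun i _ => by positivity,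
      ← Finset.prod_mul_distrib]
    refine Finset.prod_congr rfl fun i _ => ?_
    rw [← ENNReal.ofReal_mul (by positivity), Pi.smul_apply, smul_eq_mul, mul_pow])
    (fun t htt => hN.smul t htt.le)]
  have hV0 : expTail N 0 ≠ 0 := by
    rw [expTail_zero_eq hN]
    exact mul_ne_zero (by exact_mod_cast Nat.factorial_ne_zero _) h0
  have hVt : expTail N 0 ≠ ⊤ := by
    rw [expTail_zero_eq hN]
    exact ENNReal.mul_ne_top (ENNReal.natCast_ne_top _) ht
  have hS : ∀ i, expFacet N i ≠ 0 := fun i => by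
    rw [expFacet_eq hN]
    exact mul_ne_zero (by exact_mod_cast Nat.factorial_ne_zero _) (facetVol_ne_zero hN h0 i)
  refine (lintegral_monomial_mul_expNeg_le hN hV0 hVt hS m).trans (le_of_eq ?_)
  rw [expTail_zero_eq hN]
  congr 1
  refine Finset.prod_congr rfl fun i _ => ?_
  rw [← expTail_zero_eq hN, expFacet_div_expTail hN]
  congr 1
  rw [div_eq_mul_inv, ← inv_pow, inv_div]

/-- Loomis–Whitney divided by the `n`-th power of the orthant volume `2^(-n)`. -/
theorem two_pow_le_prod_facetRatio (hN : IsMonotoneGauge N) [Nonempty ι]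
    (hv : orthantVol N = (2 ^ Fintype.card ι)⁻¹) :
    (2 : ℝ) ^ Fintype.card ι ≤ ∏ i, facetRatio N i := by
  have h0 : orthantVol N ≠ 0 := by rw [hv]; simp
  have ht : orthantVol N ≠ ⊤ := by rw [hv]; simp
  have h := ENNReal.toReal_mono (ENNReal.prod_ne_top fun i _ => facetVol_ne_top hN ht i)
    (orthantVol_pow_le hN)
  have hr : (orthantVol N).toReal = ((2 : ℝ) ^ Fintype.card ι)⁻¹ := by rw [hv]; simp
  have hp : 0 < (orthantVol N).toReal := ENNReal.toReal_pos h0 ht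
  rw [ENNReal.toReal_pow, ENNReal.toReal_prod] at h
  have e : ∏ i, facetRatio N i =
      (∏ i, (facetVol N i).toReal) / (orthantVol N).toReal ^ Fintype.card ι := by
    simp [facetRatio, ENNReal.toReal_div, Finset.prod_div_distrib]
  rw [e, le_div_iff₀ (by positivity)]
  refine le_trans (le_of_eq ?_) h
  obtain ⟨k, hk⟩ := Nat.exists_eq_succ_of_ne_zero (Fintype.card_ne_zero (α := ι))
  rw [hk] at hr ⊢
  rw [Nat.succ_sub_one, pow_succ (orthantVol N).toReal, mul_comm ((orthantVol N).toReal ^ k),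
    ← mul_assoc, hr, mul_inv_cancel₀ (by positivity), one_mul]

/-- In isotropic position, every coordinate section of the positive part of the unit ball has
relative volume at least `√(2 / 3)`. -/
theorem two_thirds_le_facetRatio_sq (hN : IsMonotoneGauge N)
    (hv : orthantVol N = (2 ^ Fintype.card ι)⁻¹) {M : ℝ}
    (hM : ∀ i, ∫⁻ x in {x | N x ≤ 1}, ENNReal.ofReal (x i ^ 2) ∂Measure.pi halfLine =
      ENNReal.ofReal M * orthantVol N) (hM0 : 0 ≤ M) (i : ι) : 2 / 3 ≤ facetRatio N i ^ 2 := by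
  have : Nonempty ι := ⟨i⟩
  have h0 : orthantVol N ≠ 0 := by rw [hv]; simp
  have ht : orthantVol N ≠ ⊤ := by rw [hv]; simp
  have hp : 0 < (orthantVol N).toReal := ENNReal.toReal_pos h0 ht
  have hc := facetRatio_pos hN h0 ht
  set n := Fintype.card ι with hn
  have hn0 : (0 : ℝ) < n := by exact_mod_cast Fintype.card_pos
  -- The moment bound at the exponent `2 e_j` reads `(n + 1)(n + 2) M r_j² ≤ 2 n²`.
  have upper : ∀ j, M * facetRatio N j ^ 2 ≤ 2 := by
    intro j
    have h := factorial_mul_lintegral_monomial_le hN h0 ht (Pi.single j 2)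
    have e1 : ∀ x : ι → ℝ, ∏ i, ENNReal.ofReal (x i ^ (Pi.single j 2 : ι → ℕ) i) =
        ENNReal.ofReal (x j ^ 2) := by
      intro x
      rw [Finset.prod_eq_single j (fun i _ hi => by simp [hi]) (by simp)]
      simp
    have e2 : ∏ i, ENNReal.ofReal (((Pi.single j 2 : ι → ℕ) i).factorial *
        (Fintype.card ι / facetRatio N i) ^ (Pi.single j 2 : ι → ℕ) i) =
        ENNReal.ofReal (2 * (n / facetRatio N j) ^ 2) := by
      rw [Finset.prod_eq_single j (fun i _ hi => by simp [hi]) (by simp)]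
      simp [hn]
    have e3 : ∑ i, (Pi.single j 2 : ι → ℕ) i = 2 := by simp
    simp_rw [e1] at h
    rw [e2, e3, hM j, ← hn] at h
    have h2 := ENNReal.toReal_mono (ENNReal.mul_ne_top (ENNReal.mul_ne_top
      (ENNReal.natCast_ne_top _) ht) ENNReal.ofReal_ne_top) h
    simp only [ENNReal.toReal_mul, ENNReal.toReal_natCast] at h2
    rw [ENNReal.toReal_ofReal hM0, ENNReal.toReal_ofReal (by positivity)] at h2
    have hcj := hc j
    have hf : ((n + 2).factorial : ℝ) = (n + 2) * (n + 1) * n.factorial := by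
      rw [Nat.factorial_succ, Nat.factorial_succ]
      push_cast
      ring
    rw [hf] at h2
    have hfp : (0 : ℝ) < n.factorial := by exact_mod_cast Nat.factorial_pos n
    have h3 : (n.factorial * (orthantVol N).toReal) * ((n + 2) * (n + 1) * M) ≤
        (n.factorial * (orthantVol N).toReal) * (2 * (n / facetRatio N j) ^ 2) := by
      linarith
    have h4 := le_of_mul_le_mul_left h3 (by positivity)
    rw [div_pow, ← mul_div_assoc, le_div_iff₀ (by positivity)] at h4
    have h5 : (n : ℝ) ^ 2 * (M * facetRatio N j ^ 2) ≤ n ^ 2 * 2 := by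
      have : (0 : ℝ) ≤ (3 * n + 2) * M * facetRatio N j ^ 2 := by positivity
      nlinarith
    exact le_of_mul_le_mul_left h5 (by positivity)
  -- Multiplying over `j` and inserting `∏ r_j ≥ 2^n` gives `M^n 4^n ≤ 2^n`.
  have hM2 : M ≤ 1 / 2 := by
    have h1 : ∏ j, (M * facetRatio N j ^ 2) ≤ 2 ^ n := by
      have := Finset.prod_le_prod (s := Finset.univ) (g := fun _ => (2 : ℝ))
        (fun j _ => mul_nonneg hM0 (sq_nonneg (facetRatio N j))) (fun j _ => upper j)
      simpa using this
    rw [Finset.prod_mul_distrib, Finset.prod_const, Finset.card_univ, Finset.prod_pow] at h1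
    have h2 := pow_le_pow_left₀ (by positivity) (two_pow_le_prod_facetRatio hN hv) 2
    have h3 : (2 * M) ^ n ≤ 1 ^ n := by
      rw [one_pow]
      have h4 : M ^ n * (2 ^ n) ^ 2 ≤ 2 ^ n := by
        refine le_trans ?_ h1
        gcongr
      have h5 : (2 : ℝ) ^ n * (2 * M) ^ n ≤ 2 ^ n * 1 := by
        rw [mul_pow]
        linarith
      exact le_of_mul_le_mul_left h5 (by positivity)
    have := (pow_le_pow_iff_left₀ (by positivity) zero_le_one (Fintype.card_ne_zero (α := ι))).1 h3
    linarith
  have hci := hc i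
  -- `T = 1 / r` maximises `T² - (2/3) r T³`; what remains is `1 / (3 r²) ≤ M`.
  have hlow := sq_mul_orthantVol_le hN i (T := (facetRatio N i)⁻¹) (by positivity)
  rw [hM i] at hlow
  have h2 := ENNReal.toReal_mono (ENNReal.add_ne_top.2 ⟨ENNReal.mul_ne_top ENNReal.ofReal_ne_top ht,
    ENNReal.mul_ne_top ENNReal.ofReal_ne_top (facetVol_ne_top hN ht i)⟩) hlow
  rw [ENNReal.toReal_add (ENNReal.mul_ne_top ENNReal.ofReal_ne_top ht)
    (ENNReal.mul_ne_top ENNReal.ofReal_ne_top (facetVol_ne_top hN ht i))] at h2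
  simp only [ENNReal.toReal_mul] at h2
  rw [ENNReal.toReal_ofReal (by positivity), ENNReal.toReal_ofReal hM0,
    ENNReal.toReal_ofReal (by positivity)] at h2
  have hb : (facetVol N i).toReal = facetRatio N i * (orthantVol N).toReal := by
    rw [facetRatio, ENNReal.toReal_div]
    field_simp
  rw [hb] at h2
  have h3 : (orthantVol N).toReal * (facetRatio N i)⁻¹ ^ 2 ≤
      (orthantVol N).toReal * (M + 2 / 3 * (facetRatio N i)⁻¹ ^ 2) := by
    have : 2 / 3 * (facetRatio N i)⁻¹ ^ 3 * (facetRatio N i * (orthantVol N).toReal) =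
        2 / 3 * (facetRatio N i)⁻¹ ^ 2 * (orthantVol N).toReal := by
      field_simp
    linarith
  have h4 := le_of_mul_le_mul_left h3 hp
  have h5 : (facetRatio N i)⁻¹ ^ 2 ≤ 3 / 2 := by linarith
  rw [inv_pow] at h5
  have h6 := inv_anti₀ (by positivity) h5
  rw [inv_inv] at h6
  linarith

theorem factorial_mul_lintegral_monomial_le_of_isotropic (hN : IsMonotoneGauge N)
    (hv : orthantVol N = (2 ^ Fintype.card ι)⁻¹) {M : ℝ}
    (hM : ∀ i, ∫⁻ x in {x | N x ≤ 1}, ENNReal.ofReal (x i ^ 2) ∂Measure.pi halfLine =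
      ENNReal.ofReal M * orthantVol N) (hM0 : 0 ≤ M) (m : ι → ℕ) {k : ℕ}
    (hm : ∑ i, m i = 2 * k) :
    (Fintype.card ι + 2 * k).factorial *
        ∫⁻ x in {x | N x ≤ 1}, ∏ i, ENNReal.ofReal (x i ^ m i) ∂Measure.pi halfLine ≤
      (Fintype.card ι).factorial * orthantVol N *
        ENNReal.ofReal ((∏ i, (m i).factorial : ℕ) * (3 / 2 * (Fintype.card ι : ℝ) ^ 2) ^ k) := by
  have h0 : orthantVol N ≠ 0 := by rw [hv]; simp
  have ht : orthantVol N ≠ ⊤ := by rw [hv]; simp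
  rw [← hm]
  refine (factorial_mul_lintegral_monomial_le hN h0 ht m).trans ?_
  gcongr
  have hc := facetRatio_pos hN h0 ht
  have hsq : ∀ i, (facetRatio N i)⁻¹ ≤ √(3 / 2) := by
    intro i
    refine Real.le_sqrt_of_sq_le ?_
    rw [inv_pow]
    have := inv_anti₀ (by norm_num) (two_thirds_le_facetRatio_sq hN hv hM hM0 i)
    linarith
  rw [← ENNReal.ofReal_prod_of_nonneg fun i _ => by have := hc i; positivity]
  refine ENNReal.ofReal_le_ofReal ?_
  calc ∏ i, (((m i).factorial : ℝ) * (Fintype.card ι / facetRatio N i) ^ m i)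
      ≤ ∏ i, (((m i).factorial : ℝ) * (Fintype.card ι * √(3 / 2)) ^ m i) := by
        refine Finset.prod_le_prod (fun i _ => by have := hc i; positivity) fun i _ => ?_
        have := hc i
        rw [div_eq_mul_inv]
        gcongr
        exact hsq i
    _ = _ := by
        rw [Finset.prod_mul_distrib, Finset.prod_pow_eq_pow_sum, hm, pow_mul, mul_pow,
          Real.sq_sqrt (by norm_num)]
        push_cast
        ring

end Isotropic

/-! ### Integration against the cone measure. -/

namespace ConvexBody

variable {n : ℕ} {K : ConvexBody (EuclideanSpace ℝ (Fin n))}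

theorem mem_iff_gauge_le_one
    (h0 : (0 : EuclideanSpace ℝ (Fin n)) ∈ interior (K : Set (EuclideanSpace ℝ (Fin n))))
    {x : EuclideanSpace ℝ (Fin n)} :
    x ∈ K ↔ gauge (K : Set (EuclideanSpace ℝ (Fin n))) x ≤ 1 := by
  rw [gauge_le_one_iff_mem_closure K.convex (mem_interior_iff_mem_nhds.1 h0),
    K.isClosed.closure_eq]
  rfl

theorem gauge_pos_of_ne_zero
    (h0 : (0 : EuclideanSpace ℝ (Fin n)) ∈ interior (K : Set (EuclideanSpace ℝ (Fin n))))
    {x : EuclideanSpace ℝ (Fin n)} (hx : x ≠ 0) :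
    0 < gauge (K : Set (EuclideanSpace ℝ (Fin n))) x :=
  (gauge_pos (absorbent_nhds_zero (mem_interior_iff_mem_nhds.1 h0))
    (NormedSpace.isVonNBounded_of_isBounded ℝ K.isBounded)).2 hx

/-- The cone measure is the image of the volume on `K` under radial projection: off the origin, a
point lies in the cone over `B` exactly when it lies in `K` and projects into `B`. -/
theorem lintegral_coneMeasure (hn : 1 ≤ n)
    (h0 : (0 : EuclideanSpace ℝ (Fin n)) ∈ interior (K : Set (EuclideanSpace ℝ (Fin n))))
    (hv : volume (K : Set (EuclideanSpace ℝ (Fin n))) = 1)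
    {G : EuclideanSpace ℝ (Fin n) → ℝ≥0∞} (hG : Measurable G) :
    ∫⁻ x, G x ∂K.coneMeasure h0 = ∫⁻ x in (K : Set (EuclideanSpace ℝ (Fin n))),
      G ((gauge (K : Set (EuclideanSpace ℝ (Fin n))) x)⁻¹ • x) := by
  have hnhds := mem_interior_iff_mem_nhds.1 h0
  have hg : Measurable (gauge (K : Set (EuclideanSpace ℝ (Fin n)))) :=
    (continuous_gauge K.convex hnhds).measurable
  have hπ : Measurable fun x : EuclideanSpace ℝ (Fin n) =>
      (gauge (K : Set (EuclideanSpace ℝ (Fin n))) x)⁻¹ • x := hg.inv.smul measurable_id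
  have : Nonempty (Fin n) := ⟨⟨0, hn⟩⟩
  have hmap : (K.coneMeasure h0).map (↑) =
      (volume.restrict (K : Set (EuclideanSpace ℝ (Fin n)))).map
        fun x => (gauge (K : Set (EuclideanSpace ℝ (Fin n))) x)⁻¹ • x := by
    ext B hB
    rw [Measure.map_apply measurable_subtype_coe hB, Measure.map_apply hπ hB, coneMeasure,
      Measure.ofMeasurable_apply _ (measurable_subtype_coe hB), hv, div_one,
      Subtype.image_preimage_coe, Measure.restrict_apply (hπ hB)]
    refine measure_congr ?_
    have hne : ∀ᵐ x : EuclideanSpace ℝ (Fin n), x ≠ 0 := by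
      simp [ae_iff]
    filter_upwards [hne] with x hx
    refine propext ?_
    have hgx := gauge_pos_of_ne_zero h0 hx
    constructor
    · rintro ⟨r, hr, b, ⟨hbK, hb⟩, rfl⟩
      have hb1 := (gauge_eq_one_iff_mem_frontier K.convex hnhds).2 hbK
      have hgr : gauge (K : Set (EuclideanSpace ℝ (Fin n))) (r • b) = r := by
        rw [gauge_smul_of_nonneg hr.1, hb1]; simp
      have hr0 : r ≠ 0 := by
        rintro rfl
        simp at hx
      refine ⟨?_, (mem_iff_gauge_le_one h0).2 (hgr.trans_le hr.2)⟩
      simp only [mem_preimage, hgr]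
      rwa [smul_smul, inv_mul_cancel₀ hr0, one_smul]
    · rintro ⟨hxB, hxK⟩
      refine ⟨_, ⟨hgx.le, (mem_iff_gauge_le_one h0).1 hxK⟩, _, ⟨?_, hxB⟩, ?_⟩
      · rw [← gauge_eq_one_iff_mem_frontier K.convex hnhds,
          gauge_smul_of_nonneg (inv_nonneg.2 hgx.le), smul_eq_mul, inv_mul_cancel₀ hgx.ne']
      · simp only [smul_smul, mul_inv_cancel₀ hgx.ne', one_smul]
  rw [← lintegral_map hG measurable_subtype_coe, hmap, lintegral_map hG hπ]

end ConvexBody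

/-- The profile is chosen so that its integral from the gauge `g` to `1` is `g^(-d) - 1`, the
relative excess of a `d`-homogeneous function at the radial projection. -/
theorem lintegral_zpow_Ici_inter_Iic {g : ℝ} (hg : 0 < g) (hg1 : g ≤ 1) (d : ℕ) :
    ∫⁻ t in Ioi 0 ∩ Ici g, (Iic 1).indicator
      (fun t : ℝ => ENNReal.ofReal (d * t ^ (-(d + 1 : ℤ)))) t =
      ENNReal.ofReal (g⁻¹ ^ d - 1) := by
  have hs : Iic (1 : ℝ) ∩ (Ioi 0 ∩ Ici g) = Icc g 1 := by
    ext t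
    simp only [mem_inter_iff, mem_Iic, mem_Ioi, mem_Ici, mem_Icc]
    constructor
    · rintro ⟨h1, h2, h3⟩; exact ⟨h3, h1⟩
    · rintro ⟨h1, h2⟩; exact ⟨h2, by linarith, h1⟩
  rw [lintegral_indicator measurableSet_Iic, Measure.restrict_restrict measurableSet_Iic, hs]
  rcases Nat.eq_zero_or_pos d with rfl | hd
  · simp
  have hcont : ContinuousOn (fun t : ℝ => (d : ℝ) * t ^ (-(d + 1 : ℤ))) (Icc g 1) := by
    refine continuousOn_const.mul (ContinuousOn.zpow₀ continuousOn_id _ fun t ht => Or.inl ?_)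
    exact (hg.trans_le ht.1).ne'
  have hu : (0 : ℝ) ∉ uIcc g 1 := by
    rw [uIcc_of_le hg1]
    intro h
    linarith [h.1]
  rw [setLIntegral_congr Ioc_ae_eq_Icc.symm, ← ofReal_integral_eq_lintegral_ofReal,
    ← intervalIntegral.integral_of_le hg1]
  · congr 1
    rw [intervalIntegral.integral_const_mul, integral_zpow (Or.inr ⟨by omega, hu⟩)]
    have hd0 : (d : ℝ) ≠ 0 := by exact_mod_cast hd.ne'
    have e : -(d + 1 : ℤ) + 1 = -d := by ring
    rw [e]
    push_cast
    rw [one_zpow, zpow_neg, zpow_natCast, inv_pow, show (-((d : ℝ) + 1) + 1) = -d by ring]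
    field_simp
    ring
  · exact hcont.integrableOn_Icc.mono_set Ioc_subset_Icc_self
  · exact (ae_restrict_iff' measurableSet_Ioc).2 (ae_of_all _ fun t ht => by
      have := hg.trans ht.1
      simp only [Pi.zero_apply]; positivity)

/-- Against `t ^ (n + d)` the same profile leaves `d t ^ (n - 1)` on `(0, 1]`; hence the
cone-measure factor `1 + d / n`. -/
theorem lintegral_zpow_mul_pow {n : ℕ} (hn : 1 ≤ n) (d : ℕ) :
    ∫⁻ t in Ioi 0, (Iic 1).indicator (fun t : ℝ => ENNReal.ofReal (d * t ^ (-(d + 1 : ℤ)))) t *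
      ENNReal.ofReal (t ^ (n + d)) = ENNReal.ofReal (d / n) := by
  have e : ∀ t : ℝ, (Iic 1).indicator (fun t : ℝ => ENNReal.ofReal (d * t ^ (-(d + 1 : ℤ)))) t *
      ENNReal.ofReal (t ^ (n + d)) = (Iic 1).indicator (fun t : ℝ =>
        ENNReal.ofReal (d * t ^ (-(d + 1 : ℤ))) * ENNReal.ofReal (t ^ (n + d))) t := fun t => by
    by_cases ht : t ∈ Iic (1 : ℝ)
    · rw [indicator_of_mem ht, indicator_of_mem ht]
    · rw [indicator_of_notMem ht, indicator_of_notMem ht, zero_mul]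
  simp_rw [e]
  rw [lintegral_indicator measurableSet_Iic, Measure.restrict_restrict measurableSet_Iic,
    inter_comm, Ioi_inter_Iic]
  have e2 : ∀ t ∈ Ioc (0 : ℝ) 1, ENNReal.ofReal (d * t ^ (-(d + 1 : ℤ))) *
      ENNReal.ofReal (t ^ (n + d)) = ENNReal.ofReal (d * t ^ (n - 1)) := by
    intro t ht
    have ht0 := ht.1
    rw [← ENNReal.ofReal_mul (by positivity), mul_assoc, ← zpow_natCast t (n + d),
      ← zpow_add₀ ht0.ne', ← zpow_natCast t (n - 1)]
    congr 3
    push_cast [hn]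
    ring
  rw [setLIntegral_congr_fun measurableSet_Ioc e2, ← ofReal_integral_eq_lintegral_ofReal,
    ← intervalIntegral.integral_of_le zero_le_one]
  · congr 1
    rw [intervalIntegral.integral_const_mul, integral_pow, Nat.sub_add_cancel hn]
    push_cast [hn]
    simp [show n ≠ 0 by omega]
    rfl
  · exact (Continuous.integrableOn_Icc (by fun_prop)).mono_set Ioc_subset_Icc_self
  · exact (ae_restrict_iff' measurableSet_Ioc).2 (ae_of_all _ fun t ht => by
      have := ht.1
      simp only [Pi.zero_apply]; positivity)

namespace ConvexBody

variable {n : ℕ} {K : ConvexBody (EuclideanSpace ℝ (Fin n))}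

/-- Integrals of homogeneous functions with respect to the cone measure. -/
theorem lintegral_coneMeasure_of_homogeneous (hn : 1 ≤ n)
    (h0 : (0 : EuclideanSpace ℝ (Fin n)) ∈ interior (K : Set (EuclideanSpace ℝ (Fin n))))
    (hv : volume (K : Set (EuclideanSpace ℝ (Fin n))) = 1)
    {F : EuclideanSpace ℝ (Fin n) → ℝ≥0∞} (hF : Measurable F) {d : ℕ}
    (hFh : ∀ t : ℝ, 0 < t → ∀ x, F (t • x) = ENNReal.ofReal (t ^ d) * F x) :
    ∫⁻ x, F x ∂K.coneMeasure h0 =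
      ENNReal.ofReal ((n + d) / n) * ∫⁻ x in (K : Set (EuclideanSpace ℝ (Fin n))), F x := by
  have hnhds := mem_interior_iff_mem_nhds.1 h0
  have hg : Measurable (gauge (K : Set (EuclideanSpace ℝ (Fin n)))) :=
    (continuous_gauge K.convex hnhds).measurable
  have : Nonempty (Fin n) := ⟨⟨0, hn⟩⟩
  have hφm : Measurable ((Iic 1).indicator
      fun t : ℝ => ENNReal.ofReal (d * t ^ (-(d + 1 : ℤ)))) :=
    Measurable.indicator (by fun_prop) measurableSet_Iic
  have h := lintegral_homogeneous_mul (μ := (volume : Measure (EuclideanSpace ℝ (Fin n)))) hF hg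
    hφm hFh (fun t ht x => by rw [gauge_smul_of_nonneg ht.le, smul_eq_mul])
  have hK : {x : EuclideanSpace ℝ (Fin n) | gauge (K : Set (EuclideanSpace ℝ (Fin n))) x ≤ 1} =
      K := by
    ext x
    exact (mem_iff_gauge_le_one h0).symm
  rw [finrank_euclideanSpace_fin, lintegral_zpow_mul_pow hn, hK] at h
  have hn0 : (n : ℝ) ≠ 0 := by exact_mod_cast (show n ≠ 0 by omega)
  rw [lintegral_coneMeasure hn h0 hv hF, add_div, div_self hn0,
    ENNReal.ofReal_add zero_le_one (by positivity), ENNReal.ofReal_one, add_mul, one_mul, ← h,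
    ← lintegral_indicator K.isCompact.measurableSet, ← lintegral_indicator K.isCompact.measurableSet,
    ← lintegral_add_left (hF.indicator K.isCompact.measurableSet)]
  refine lintegral_congr_ae ?_
  have hne : ∀ᵐ x : EuclideanSpace ℝ (Fin n), x ≠ 0 := by
    simp [ae_iff]
  filter_upwards [hne] with x hx
  have hgx := gauge_pos_of_ne_zero h0 hx
  by_cases hxK : x ∈ (K : Set (EuclideanSpace ℝ (Fin n)))
  · have hg1 := (mem_iff_gauge_le_one h0).1 hxK
    rw [indicator_of_mem hxK, indicator_of_mem hxK, lintegral_zpow_Ici_inter_Iic hgx hg1,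
      hFh _ (inv_pos.2 hgx), mul_comm]
    have h1 : 1 ≤ (gauge (K : Set (EuclideanSpace ℝ (Fin n))) x)⁻¹ ^ d :=
      one_le_pow₀ ((one_le_inv₀ hgx).2 hg1)
    rw [← mul_one_add, ← ENNReal.ofReal_one, ← ENNReal.ofReal_add zero_le_one (by linarith)]
    congr 2
    ring
  · have hg1 : 1 < gauge (K : Set (EuclideanSpace ℝ (Fin n))) x := by
      by_contra hle
      exact hxK ((mem_iff_gauge_le_one h0).2 (not_lt.1 hle))
    rw [indicator_of_notMem hxK, indicator_of_notMem hxK, zero_add]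
    have : ∫⁻ t in Ioi 0 ∩ Ici (gauge (K : Set (EuclideanSpace ℝ (Fin n))) x), (Iic 1).indicator
        (fun t : ℝ => ENNReal.ofReal (d * t ^ (-(d + 1 : ℤ)))) t = 0 := by
      refine (setLIntegral_congr_fun (g := fun _ => 0) (measurableSet_Ioi.inter measurableSet_Ici)
        fun t ht => ?_).trans (by simp)
      refine indicator_of_notMem ?_ _
      exact not_le.2 (hg1.trans_le ht.2)
    rw [this, mul_zero]

end ConvexBody

/-! ### The gauge in coordinates and monomial moments of `K`. -/

namespace ConvexBody

variable {n : ℕ} {K : ConvexBody (EuclideanSpace ℝ (Fin n))}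

/-- The gauge of `K` as a function of the coordinates. -/
noncomputable def coordGauge (K : ConvexBody (EuclideanSpace ℝ (Fin n))) (x : Fin n → ℝ) : ℝ :=
  gauge (K : Set (EuclideanSpace ℝ (Fin n))) (WithLp.toLp 2 x)

theorem coordGauge_le_one_iff
    (h0 : (0 : EuclideanSpace ℝ (Fin n)) ∈ interior (K : Set (EuclideanSpace ℝ (Fin n))))
    {x : Fin n → ℝ} : K.coordGauge x ≤ 1 ↔ WithLp.toLp 2 x ∈ K :=
  (mem_iff_gauge_le_one h0).symm

theorem coordGauge_smul {t : ℝ} (ht : 0 ≤ t) (x : Fin n → ℝ) :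
    K.coordGauge (t • x) = t * K.coordGauge x := by
  rw [coordGauge, WithLp.toLp_smul, gauge_smul_of_nonneg ht, smul_eq_mul, coordGauge]

theorem coordGauge_add_le
    (h0 : (0 : EuclideanSpace ℝ (Fin n)) ∈ interior (K : Set (EuclideanSpace ℝ (Fin n))))
    (x y : Fin n → ℝ) : K.coordGauge (x + y) ≤ K.coordGauge x + K.coordGauge y := by
  rw [coordGauge, WithLp.toLp_add]
  exact gauge_add_le K.convex (absorbent_nhds_zero (mem_interior_iff_mem_nhds.1 h0)) _ _

theorem IsUnconditional.coordGauge_update_neg_le (hK : K.IsUnconditional)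
    (h0 : (0 : EuclideanSpace ℝ (Fin n)) ∈ interior (K : Set (EuclideanSpace ℝ (Fin n))))
    (x : Fin n → ℝ) (i : Fin n) :
    K.coordGauge (Function.update x i (-x i)) ≤ K.coordGauge x := by
  refine le_of_forall_gt_imp_ge_of_dense fun a ha => ?_
  have ha0 : 0 < a := (gauge_nonneg _).trans_lt ha
  have h1 : K.coordGauge (a⁻¹ • x) ≤ 1 := by
    rw [coordGauge_smul (by positivity), inv_mul_le_iff₀ ha0]
    linarith
  have h2 := hK i _ ((coordGauge_le_one_iff h0).1 h1)
  have e : Function.update (a⁻¹ • x) i (-(a⁻¹ • x) i) = a⁻¹ • Function.update x i (-x i) := by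
    ext j
    by_cases hj : j = i
    · subst hj; simp
    · simp [hj]
  have h3 : K.coordGauge (a⁻¹ • Function.update x i (-x i)) ≤ 1 := by
    rw [← e]
    exact (coordGauge_le_one_iff h0).2 h2
  rw [coordGauge_smul (by positivity), inv_mul_le_iff₀ ha0] at h3
  linarith

theorem IsUnconditional.coordGauge_update_neg (hK : K.IsUnconditional)
    (h0 : (0 : EuclideanSpace ℝ (Fin n)) ∈ interior (K : Set (EuclideanSpace ℝ (Fin n))))
    (x : Fin n → ℝ) (i : Fin n) :
    K.coordGauge (Function.update x i (-x i)) = K.coordGauge x := by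
  refine le_antisymm (hK.coordGauge_update_neg_le h0 x i) ?_
  simpa using hK.coordGauge_update_neg_le h0 (Function.update x i (-x i)) i

/-- The new point lies on the segment from `y` to its reflection in coordinate `i`; both ends have
the same gauge, so sublinearity applies. -/
theorem IsUnconditional.coordGauge_update_le (hK : K.IsUnconditional)
    (h0 : (0 : EuclideanSpace ℝ (Fin n)) ∈ interior (K : Set (EuclideanSpace ℝ (Fin n))))
    (y : Fin n → ℝ) (i : Fin n) {s : ℝ} (hs0 : 0 ≤ s) (hs : s ≤ y i) :
    K.coordGauge (Function.update y i s) ≤ K.coordGauge y := by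
  rcases (hs0.trans hs).eq_or_lt with h | h
  · have : s = y i := by linarith
    rw [this, Function.update_eq_self]
  set l : ℝ := (1 + s / y i) / 2 with hl
  have hq0 : 0 ≤ s / y i := by positivity
  have hq1 : s / y i ≤ 1 := (div_le_one h).2 hs
  have hl0 : 0 ≤ l := by positivity
  have hl1 : 0 ≤ 1 - l := by rw [hl]; linarith
  have e : Function.update y i s = l • y + (1 - l) • Function.update y i (-y i) := by
    ext j
    by_cases hj : j = i
    · subst hj
      simp only [Function.update_self, Pi.add_apply, Pi.smul_apply, smul_eq_mul, hl]
      field_simp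
      ring
    · simp [hj]
      ring
  have h1 := coordGauge_add_le h0 (l • y) ((1 - l) • Function.update y i (-y i))
  rw [coordGauge_smul hl0, coordGauge_smul hl1, hK.coordGauge_update_neg h0, ← e] at h1
  linarith

theorem IsUnconditional.isMonotoneGauge (hK : K.IsUnconditional)
    (h0 : (0 : EuclideanSpace ℝ (Fin n)) ∈ interior (K : Set (EuclideanSpace ℝ (Fin n)))) :
    IsMonotoneGauge K.coordGauge where
  cont := (continuous_gauge K.convex (mem_interior_iff_mem_nhds.1 h0)).comp
    (PiLp.continuous_toLp 2 _)
  smul t ht x := coordGauge_smul ht x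
  add_le := coordGauge_add_le h0
  nonneg _ := gauge_nonneg _
  mono x y hx hxy := by
    have key : ∀ T : Finset (Fin n), K.coordGauge (T.piecewise x y) ≤ K.coordGauge y := by
      intro T
      induction T using Finset.induction with
      | empty => simp
      | insert i T hi ih =>
        rw [Finset.piecewise_insert]
        refine (hK.coordGauge_update_le h0 _ i (hx i) ?_).trans ih
        simpa [hi] using hxy i
    simpa using key Finset.univ

theorem setLIntegral_eq_coordGauge
    (h0 : (0 : EuclideanSpace ℝ (Fin n)) ∈ interior (K : Set (EuclideanSpace ℝ (Fin n))))
    (G : EuclideanSpace ℝ (Fin n) → ℝ≥0∞) :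
    ∫⁻ x in (K : Set (EuclideanSpace ℝ (Fin n))), G x =
      ∫⁻ y in {y | K.coordGauge y ≤ 1}, G (WithLp.toLp 2 y) := by
  have h := (PiLp.volume_preserving_toLp (Fin n)).setLIntegral_comp_preimage_emb
    (MeasurableEquiv.toLp 2 (Fin n → ℝ)).measurableEmbedding G K
  rw [← h]
  congr 2
  ext y
  exact (coordGauge_le_one_iff h0).symm

/-- Reduction of integrals over `K` to the positive orthant. -/
theorem IsUnconditional.lintegral_coord_eq_two_pow_mul (hK : K.IsUnconditional)
    (h0 : (0 : EuclideanSpace ℝ (Fin n)) ∈ interior (K : Set (EuclideanSpace ℝ (Fin n))))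
    {G : (Fin n → ℝ) → ℝ≥0∞} (hG : Measurable G)
    (he : ∀ x i, G (Function.update x i (-x i)) = G x) :
    ∫⁻ y in {y | K.coordGauge y ≤ 1}, G y =
      2 ^ n * ∫⁻ y in {y | K.coordGauge y ≤ 1}, G y ∂Measure.pi halfLine := by
  have hm := (hK.isMonotoneGauge h0).measurableSet_unitBall
  rw [← lintegral_indicator hm, ← lintegral_indicator hm,
    lintegral_eq_two_pow_mul_of_even (hG.indicator hm), Fintype.card_fin]
  intro x i
  simp only [indicator, mem_ofPred_eq, hK.coordGauge_update_neg h0, he]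

theorem IsUnconditional.orthantVol_coordGauge (hK : K.IsUnconditional)
    (h0 : (0 : EuclideanSpace ℝ (Fin n)) ∈ interior (K : Set (EuclideanSpace ℝ (Fin n))))
    (hv : volume (K : Set (EuclideanSpace ℝ (Fin n))) = 1) :
    orthantVol K.coordGauge = (2 ^ n)⁻¹ := by
  have h := setLIntegral_eq_coordGauge h0 (fun _ => 1)
  rw [hK.lintegral_coord_eq_two_pow_mul h0 measurable_const (fun _ _ => rfl), setLIntegral_one,
    setLIntegral_one, hv] at h
  exact ENNReal.eq_inv_of_mul_eq_one_left (by rw [mul_comm]; exact h.symm)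

/-- `M` is `L²`: the factor `2^n` from the reflections cancels against the orthant volume. -/
theorem IsIsotropic.exists_lintegral_sq_eq (hiso : K.IsIsotropic) (hK : K.IsUnconditional)
    (h0 : (0 : EuclideanSpace ℝ (Fin n)) ∈ interior (K : Set (EuclideanSpace ℝ (Fin n)))) :
    ∃ M : ℝ, 0 ≤ M ∧ ∀ i, ∫⁻ x in {x | K.coordGauge x ≤ 1}, ENNReal.ofReal (x i ^ 2)
      ∂Measure.pi halfLine = ENNReal.ofReal M * orthantVol K.coordGauge := by
  obtain ⟨L, hL⟩ := hiso.exists_isotropic_constant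
  refine ⟨L ^ 2, sq_nonneg L, fun i => ?_⟩
  have h1 := hL (EuclideanSpace.single i 1) (by simp)
  have h2 : ∫⁻ x in (K : Set (EuclideanSpace ℝ (Fin n))),
      ENNReal.ofReal (inner ℝ x (EuclideanSpace.single i 1) ^ 2) = ENNReal.ofReal (L ^ 2) := by
    rw [← h1, ofReal_integral_eq_lintegral_ofReal]
    · exact (Continuous.continuousOn (by fun_prop)).integrableOn_compact K.isCompact
    · exact ae_of_all _ fun x => sq_nonneg _
  rw [setLIntegral_eq_coordGauge h0] at h2
  simp only [EuclideanSpace.inner_single_right, conj_trivial, one_mul] at h2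
  rw [hK.lintegral_coord_eq_two_pow_mul h0 (G := fun y => ENNReal.ofReal (y i ^ 2)) (by fun_prop)] at h2
  · rw [hK.orthantVol_coordGauge h0 hiso.volume_eq_one, ← h2, mul_comm, ← mul_assoc,
      ENNReal.inv_mul_cancel (by simp) (by simp), one_mul]
  · intro x j
    by_cases hj : i = j
    · subst hj; simp
    · simp [hj]

/-- Moment bound for even monomials on an unconditional isotropic convex body. -/
theorem IsIsotropic.factorial_mul_lintegral_monomial_le (hiso : K.IsIsotropic)
    (hK : K.IsUnconditional)
    (h0 : (0 : EuclideanSpace ℝ (Fin n)) ∈ interior (K : Set (EuclideanSpace ℝ (Fin n))))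
    (m : Fin n → ℕ) (hme : ∀ i, 2 ∣ m i) {k : ℕ} (hm : ∑ i, m i = 2 * k) :
    (n + 2 * k).factorial *
        ∫⁻ x in {x | K.coordGauge x ≤ 1}, ENNReal.ofReal (∏ i, x i ^ m i) ≤
      ENNReal.ofReal (n.factorial * (∏ i, (m i).factorial : ℕ) * (3 / 2 * (n : ℝ) ^ 2) ^ k) := by
  obtain ⟨M, hM0, hM⟩ := hiso.exists_lintegral_sq_eq hK h0
  have hv := hK.orthantVol_coordGauge h0 hiso.volume_eq_one
  have h := factorial_mul_lintegral_monomial_le_of_isotropic (hK.isMonotoneGauge h0)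
    (by rw [hv, Fintype.card_fin]) hM hM0 m hm
  have hev : ∀ i, Even (m i) := fun i => even_iff_two_dvd.2 (hme i)
  have e : ∀ x : Fin n → ℝ, ENNReal.ofReal (∏ i, x i ^ m i) = ∏ i, ENNReal.ofReal (x i ^ m i) :=
    fun x => ENNReal.ofReal_prod_of_nonneg fun i _ => (hev i).pow_nonneg _
  simp_rw [e]
  rw [hK.lintegral_coord_eq_two_pow_mul h0]
  · rw [Fintype.card_fin, hv] at h
    rw [mul_left_comm]
    refine (mul_le_mul_right h _).trans (le_of_eq ?_)
    rw [mul_comm (n.factorial : ℝ≥0∞), ← mul_assoc, ← mul_assoc,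
      ENNReal.mul_inv_cancel (by simp) (by simp), one_mul, ← ENNReal.ofReal_natCast n.factorial,
      ← ENNReal.ofReal_mul (by positivity), mul_assoc]
  · exact Finset.measurable_prod _ fun i _ => by fun_prop
  · intro x i
    refine Finset.prod_congr rfl fun j _ => ?_
    by_cases hj : j = i
    · subst hj; simp [(hev j).neg_pow]
    · simp [hj]

end ConvexBody

/-! ### Binomial estimates and counting of even multi-indices. -/

/-- The factor `2` becomes the `½` in the moment bound, without which the final series would exceed
`1`. -/
theorem two_mul_centralBinom_le_four_pow {k : ℕ} (hk : 1 ≤ k) : 2 * k.centralBinom ≤ 4 ^ k := by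
  induction k, hk using Nat.le_induction with
  | base => simp [Nat.centralBinom]
  | succ k hk ih =>
    have h := Nat.succ_mul_centralBinom_succ k
    have h2 : (k + 1) * (2 * (k + 1).centralBinom) ≤ (k + 1) * 4 ^ (k + 1) := by
      rw [pow_succ]
      nlinarith
    exact Nat.le_of_mul_le_mul_left h2 k.succ_pos

/-- Cancelling factorials leaves `(2k choose k) ≤ 4^k / 2` and `(n + k - 1)! n^k ≤ (n + 2k - 1)!`;
then `4^k / 6^k = (2/3)^k`. -/
theorem choose_mul_factorial_mul_pow_le {n k : ℕ} (hn : 1 ≤ n) (hk : 1 ≤ k) :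
    ((n + 2 * k : ℝ) * (n + k - 1).choose k * (2 * k).factorial * n.factorial) * (n / 6) ^ k ≤
      (1 / 2 * (2 / 3) ^ k) * (n * k.factorial * (n + 2 * k).factorial) := by
  obtain ⟨p, rfl⟩ := Nat.exists_eq_succ_of_ne_zero (show n ≠ 0 by omega)
  have e1 : p.succ + k - 1 = p + k := by omega
  have h1 : ((p + k).choose k : ℝ) * p.factorial * k.factorial = (p + k).factorial := by
    have := Nat.add_choose_mul_factorial_mul_factorial p k
    exact_mod_cast this
  have h2 : ((p.succ + 2 * k).factorial : ℝ) = (p.succ + 2 * k) * (p + 2 * k).factorial := by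
    rw [show p.succ + 2 * k = (p + 2 * k) + 1 by omega, Nat.factorial_succ]
    push_cast
    ring
  have h3 : ((2 * k).factorial : ℝ) = k.centralBinom * k.factorial * k.factorial := by
    have := Nat.choose_mul_factorial_mul_factorial (show k ≤ 2 * k by omega)
    rw [show 2 * k - k = k by omega] at this
    rw [Nat.centralBinom]
    exact_mod_cast this.symm
  have h4 : (2 : ℝ) * k.centralBinom ≤ 4 ^ k := by
    exact_mod_cast two_mul_centralBinom_le_four_pow hk
  have h5 : ((p + k).factorial : ℝ) * p.succ ^ k ≤ (p + 2 * k).factorial := by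
    have h := Nat.factorial_mul_pow_le_factorial (m := p + k) (n := k)
    rw [show p + k + k = p + 2 * k by omega] at h
    refine le_trans ?_ (by exact_mod_cast h :
      ((p + k).factorial : ℝ) * ((p + k + 1 : ℕ) : ℝ) ^ k ≤ (p + 2 * k).factorial)
    gcongr
    omega
  have h6 : (p.succ.factorial : ℝ) = p.succ * p.factorial := by
    rw [Nat.factorial_succ]; push_cast; ring
  have hkf : (0 : ℝ) < k.factorial := by exact_mod_cast Nat.factorial_pos k
  rw [e1, h2, h3, h6]
  refine le_of_mul_le_mul_left ?_ hkf
  set A : ℝ := (p.succ + 2 * k) * p.succ * k.factorial * k.factorial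
  have hA : 0 ≤ A := by positivity
  calc _ = A * ((k.centralBinom * ((((p + k).choose k : ℝ) * p.factorial * k.factorial) *
          p.succ ^ k)) / 6 ^ k) := by
        rw [div_pow]; ring
    _ ≤ A * (((1 / 2 * 4 ^ k) * (p + 2 * k).factorial) / 6 ^ k) := by
        rw [h1]
        gcongr
        linarith
    _ = _ := by
        rw [show (6 : ℝ) = 2 * 3 by norm_num, show (4 : ℝ) = 2 * 2 by norm_num, mul_pow, mul_pow,
          div_pow]
        field_simp
        ring

/-- Halving the exponents leaves the multi-indices of total `k`, that is, multisets of size `k` in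
`Fin n`. -/
theorem card_filter_dvd_piAntidiag (n k : ℕ) :
    ((Finset.piAntidiag (Finset.univ : Finset (Fin n)) (2 * k)).filter fun m => ∀ i, 2 ∣ m i).card =
      (n + k - 1).choose k := by
  have h := congrArg Finset.card
    (Finset.map_nsmul_piAntidiag_univ (ι := Fin n) k two_ne_zero)
  rw [Finset.card_map, ← Finset.map_sym_eq_piAntidiag, Finset.card_map, Finset.sym_univ,
    Finset.card_univ, Sym.card_sym_eq_choose, Fintype.card_fin] at h
  convert h.symm

/-! ### Vanishing of odd monomials. -/

section Reflection

variable {n : ℕ}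

theorem measurable_update_neg (i : Fin n) :
    Measurable fun y : Fin n → ℝ => Function.update y i (-y i) := by
  rw [measurable_pi_iff]
  intro j
  by_cases hj : j = i
  · subst hj
    simp only [Function.update_self]
    fun_prop
  · simp only [Function.update_of_ne hj]
    fun_prop

/-- The reflection `x i ↦ -x i`. -/
def coordReflection (i : Fin n) : (Fin n → ℝ) ≃ᵐ (Fin n → ℝ) where
  toFun y := Function.update y i (-y i)
  invFun y := Function.update y i (-y i)
  left_inv y := by simp
  right_inv y := by simp
  measurable_toFun := measurable_update_neg i
  measurable_invFun := measurable_update_neg i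

theorem measurePreserving_coordReflection (i : Fin n) :
    MeasurePreserving (coordReflection i) volume volume := by
  have h := volume_preserving_pi (α' := fun _ : Fin n => ℝ) (β' := fun _ : Fin n => ℝ)
    (f := fun j t => if j = i then -t else t) (fun j => by
      by_cases hj : j = i
      · simpa [hj] using Measure.measurePreserving_neg (volume : Measure ℝ)
      · simp only [hj, if_false]
        exact MeasurePreserving.id (volume : Measure ℝ))
  have e : ⇑(coordReflection i) = fun (y : Fin n → ℝ) j => if j = i then -y j else y j := by
    funext y j
    by_cases hj : j = i
    · subst hj; simp [coordReflection]
    · simp [coordReflection, hj]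
  rw [e]
  exact h

theorem setIntegral_monomial_eq_zero {S : Set (Fin n → ℝ)} (hSm : MeasurableSet S) {i : Fin n}
    (hS : ∀ x, Function.update x i (-x i) ∈ S ↔ x ∈ S) {m : Fin n → ℕ} (hm : ¬ 2 ∣ m i) :
    ∫ x in S, ∏ j, x j ^ m j = 0 := by
  have hodd : Odd (m i) := by
    rw [← Nat.not_even_iff_odd, even_iff_two_dvd]
    exact hm
  have h := (measurePreserving_coordReflection i).integral_comp' (S.indicator fun x =>
    ∏ j, x j ^ m j)
  have e : ∀ x, S.indicator (fun x => ∏ j, x j ^ m j) (coordReflection i x) =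
      -S.indicator (fun x => ∏ j, x j ^ m j) x := by
    intro x
    have e1 : ∏ j, (coordReflection i x) j ^ m j = -∏ j, x j ^ m j := by
      rw [← Finset.mul_prod_erase _ _ (Finset.mem_univ i),
        ← Finset.mul_prod_erase _ (fun j => x j ^ m j) (Finset.mem_univ i), ← neg_mul]
      congr 1
      · simp [coordReflection, hodd.neg_pow]
      · refine Finset.prod_congr rfl fun j hj => ?_
        simp [coordReflection, Finset.ne_of_mem_erase hj]
    have e2 : coordReflection i x ∈ S ↔ x ∈ S := hS x
    by_cases hx : x ∈ S
    · rw [indicator_of_mem (e2.2 hx), indicator_of_mem hx, e1]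
    · rw [indicator_of_notMem (fun h => hx (e2.1 h)), indicator_of_notMem hx, neg_zero]
  simp_rw [e] at h
  rw [integral_neg, integral_indicator hSm] at h
  linarith

end Reflection

/-! ### Even moments of linear functionals. -/

namespace ConvexBody

variable {n : ℕ} {K : ConvexBody (EuclideanSpace ℝ (Fin n))}

theorem isCompact_coordGauge_le_one
    (h0 : (0 : EuclideanSpace ℝ (Fin n)) ∈ interior (K : Set (EuclideanSpace ℝ (Fin n)))) :
    IsCompact {x | K.coordGauge x ≤ 1} := by
  have h := K.isCompact.image (PiLp.continuous_ofLp 2 fun _ : Fin n => ℝ)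
  convert h using 1
  ext x
  rw [mem_ofPred_eq, coordGauge_le_one_iff h0]
  constructor
  · intro hx
    exact ⟨_, hx, rfl⟩
  · rintro ⟨y, hy, rfl⟩
    exact hy

theorem IsIsotropic.factorial_mul_setIntegral_monomial_le (hiso : K.IsIsotropic)
    (hK : K.IsUnconditional)
    (h0 : (0 : EuclideanSpace ℝ (Fin n)) ∈ interior (K : Set (EuclideanSpace ℝ (Fin n))))
    (m : Fin n → ℕ) (hme : ∀ i, 2 ∣ m i) {k : ℕ} (hm : ∑ i, m i = 2 * k) :
    (n + 2 * k).factorial * ∫ x in {x | K.coordGauge x ≤ 1}, ∏ i, x i ^ m i ≤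
      n.factorial * (∏ i, (m i).factorial : ℕ) * (3 / 2 * (n : ℝ) ^ 2) ^ k := by
  have h := hiso.factorial_mul_lintegral_monomial_le hK h0 m hme hm
  have hev : ∀ i, Even (m i) := fun i => even_iff_two_dvd.2 (hme i)
  have hnn : ∀ x : Fin n → ℝ, 0 ≤ ∏ i, x i ^ m i := fun x =>
    Finset.prod_nonneg fun i _ => (hev i).pow_nonneg _
  rw [← ofReal_integral_eq_lintegral_ofReal
    ((Continuous.continuousOn (by fun_prop)).integrableOn_compact (isCompact_coordGauge_le_one h0))
    (ae_of_all _ hnn), ← ENNReal.ofReal_natCast, ← ENNReal.ofReal_mul (by positivity)] at h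
  exact (ENNReal.ofReal_le_ofReal_iff (by positivity)).1 h

/-- In the multinomial expansion, terms with an odd exponent vanish by reflection. For the others
the multinomial coefficient times `∏ m_i!` is `(2k)!`, so all of them share one bound and only their
number matters. -/
theorem IsIsotropic.factorial_mul_setIntegral_pow_le (hiso : K.IsIsotropic)
    (hK : K.IsUnconditional)
    (h0 : (0 : EuclideanSpace ℝ (Fin n)) ∈ interior (K : Set (EuclideanSpace ℝ (Fin n))))
    (θ : Fin n → ℝ) (k : ℕ) :
    (n + 2 * k).factorial * ∫ x in {x | K.coordGauge x ≤ 1}, (∑ i, θ i * x i) ^ (2 * k) ≤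
      (n + k - 1).choose k * ((2 * k).factorial * n.factorial * ‖θ‖ ^ (2 * k) *
        (3 / 2 * (n : ℝ) ^ 2) ^ k) := by
  have hm := (hK.isMonotoneGauge h0).measurableSet_unitBall
  have e : ∫ x in {x | K.coordGauge x ≤ 1}, (∑ i, θ i * x i) ^ (2 * k) =
      ∑ m ∈ Finset.piAntidiag Finset.univ (2 * k), (Nat.multinomial Finset.univ m * ∏ i, θ i ^ m i) *
        ∫ x in {x | K.coordGauge x ≤ 1}, ∏ i, x i ^ m i := by
    simp_rw [Finset.sum_pow_eq_sum_piAntidiag, mul_pow, Finset.prod_mul_distrib]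
    rw [integral_finsetSum]
    · refine Finset.sum_congr rfl fun m _ => ?_
      rw [← integral_const_mul]
      simp_rw [mul_assoc]
    · intro m _
      exact (Continuous.continuousOn (by fun_prop)).integrableOn_compact
        (isCompact_coordGauge_le_one h0)
  rw [e, Finset.mul_sum, ← Finset.sum_filter_of_ne (p := fun m => ∀ i, 2 ∣ m i),
    ← card_filter_dvd_piAntidiag, ← nsmul_eq_mul]
  · refine Finset.sum_le_card_nsmul _ _ _ fun m hmem => ?_
    obtain ⟨hma, hme⟩ := Finset.mem_filter.1 hmem
    have hsum : ∑ i, m i = 2 * k := (Finset.mem_piAntidiag.1 hma).1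
    have hmono := hiso.factorial_mul_setIntegral_monomial_le hK h0 m hme hsum
    have hev : ∀ i, Even (m i) := fun i => even_iff_two_dvd.2 (hme i)
    have hθ0 : 0 ≤ ∏ i, θ i ^ m i := Finset.prod_nonneg fun i _ => (hev i).pow_nonneg _
    have hθ : ∏ i, θ i ^ m i ≤ ‖θ‖ ^ (2 * k) := by
      rw [← hsum, ← Finset.prod_pow_eq_pow_sum]
      refine Finset.prod_le_prod (fun i _ => (hev i).pow_nonneg _) fun i _ => ?_
      rw [← (hev i).pow_abs]
      exact pow_le_pow_left₀ (abs_nonneg _) (norm_le_pi_norm θ i) _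
    have hmult : ((∏ i, (m i).factorial : ℕ) : ℝ) * Nat.multinomial Finset.univ m =
        (2 * k).factorial := by
      have := Nat.multinomial_spec Finset.univ m
      rw [hsum] at this
      exact_mod_cast this
    calc _ = (Nat.multinomial Finset.univ m * ∏ i, θ i ^ m i) * ((n + 2 * k).factorial *
          ∫ x in {x | K.coordGauge x ≤ 1}, ∏ i, x i ^ m i) := by ring
      _ ≤ (Nat.multinomial Finset.univ m * ‖θ‖ ^ (2 * k)) *
          (n.factorial * (∏ i, (m i).factorial : ℕ) * (3 / 2 * (n : ℝ) ^ 2) ^ k) := by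
        refine (mul_le_mul_of_nonneg_left hmono (by positivity)).trans ?_
        gcongr
      _ = _ := by rw [← hmult]; ring
  · intro m _ hne
    by_contra hcon
    push Not at hcon
    obtain ⟨i, hi⟩ := hcon
    apply hne
    rw [setIntegral_monomial_eq_zero hm (fun x => by
      rw [mem_ofPred_eq, hK.coordGauge_update_neg h0]; rfl) hi, mul_zero, mul_zero]

/-- Even moments of linear functionals with respect to the cone measure. -/
theorem IsIsotropic.lintegral_coneMeasure_inner_pow_le (hn : 1 ≤ n) (hiso : K.IsIsotropic)
    (hK : K.IsUnconditional)
    (h0 : (0 : EuclideanSpace ℝ (Fin n)) ∈ interior (K : Set (EuclideanSpace ℝ (Fin n))))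
    (θ : EuclideanSpace ℝ (Fin n)) {k : ℕ} (hk : 1 ≤ k) :
    ∫⁻ x, ENNReal.ofReal (inner ℝ (x : EuclideanSpace ℝ (Fin n)) θ ^ (2 * k)) ∂K.coneMeasure h0 ≤
      ENNReal.ofReal (1 / 2 * (2 / 3) ^ k * k.factorial * (3 * √(n : ℝ) * ‖θ.ofLp‖) ^ (2 * k)) := by
  rw [lintegral_coneMeasure_of_homogeneous (d := 2 * k)
    (F := fun x => ENNReal.ofReal (inner ℝ x θ ^ (2 * k))) hn h0 hiso.volume_eq_one (by fun_prop)
    (fun t ht x => by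
      rw [real_inner_smul_left, mul_pow, ENNReal.ofReal_mul (by positivity)]),
    setLIntegral_eq_coordGauge h0]
  have e : ∀ y : Fin n → ℝ, inner ℝ (WithLp.toLp 2 y) θ = ∑ i, θ i * y i := by
    intro y
    simp [PiLp.inner_apply]
  simp_rw [e]
  rw [← ofReal_integral_eq_lintegral_ofReal
    ((Continuous.continuousOn (by fun_prop)).integrableOn_compact (isCompact_coordGauge_le_one h0))
    (ae_of_all _ fun x => (even_two_mul k).pow_nonneg _), ← ENNReal.ofReal_mul (by positivity)]
  refine ENNReal.ofReal_le_ofReal ?_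
  have h1 := hiso.factorial_mul_setIntegral_pow_le hK h0 θ.ofLp k
  have h2 := choose_mul_factorial_mul_pow_le hn hk
  have hn0 : (0 : ℝ) < n := by exact_mod_cast hn
  set I := ∫ x in {x | K.coordGauge x ≤ 1}, (∑ i, θ i * x i) ^ (2 * k)
  set f : ℝ := ((n + 2 * k).factorial : ℝ)
  have hf : 0 < f := Nat.cast_pos.2 (Nat.factorial_pos _)
  have e9 : (3 * √(n : ℝ) * ‖θ.ofLp‖) ^ (2 * k) = 9 ^ k * n ^ k * ‖θ.ofLp‖ ^ (2 * k) := by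
    rw [mul_pow, mul_pow, pow_mul, pow_mul (√(n : ℝ)), Real.sq_sqrt hn0.le]
    norm_num
  -- Splits off `9 n = (3 √n)²`, the target scale; the remaining `n / 6` is absorbed by the binomial
  -- estimate.
  have hpow : (3 / 2 * (n : ℝ) ^ 2) ^ k = (n / 6) ^ k * (9 ^ k * n ^ k) := by
    rw [← mul_pow, ← mul_pow]
    congr 1
    ring
  rw [e9, div_mul_eq_mul_div, div_le_iff₀ hn0]
  refine le_of_mul_le_mul_left ?_ hf
  push_cast
  calc f * ((n + 2 * k) * I) = (n + 2 * k) * (f * I) := by ring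
    _ ≤ (n + 2 * k) * ((n + k - 1).choose k * ((2 * k).factorial * n.factorial *
        ‖θ.ofLp‖ ^ (2 * k) * (3 / 2 * (n : ℝ) ^ 2) ^ k)) := by gcongr
    _ = (((n + 2 * k : ℝ) * (n + k - 1).choose k * (2 * k).factorial * n.factorial) * (n / 6) ^ k) *
        (9 ^ k * n ^ k * ‖θ.ofLp‖ ^ (2 * k)) := by rw [hpow]; ring
    _ ≤ ((1 / 2 * (2 / 3) ^ k) * (n * k.factorial * f)) *
        (9 ^ k * n ^ k * ‖θ.ofLp‖ ^ (2 * k)) := by gcongr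
    _ = _ := by ring

end ConvexBody

/-! ### From even moments to the ψ₂-norm. -/

theorem hasSum_psiTwo (y : ℝ) :
    HasSum (fun k : ℕ => y ^ (2 * (k + 1)) / (k + 1).factorial) (psiTwo y) := by
  have h := NormedSpace.expSeries_div_hasSum_exp (𝔸 := ℝ) (y ^ 2)
  rw [← Real.exp_eq_exp_ℝ] at h
  have h2 := (hasSum_nat_add_iff' 1).2 h
  simpa [psiTwo, pow_mul] using h2

/-- Integrate the exponential series term by term: the `k`-th term is at most `½ (2/3)^k`, and these
sum to `1` over `k ≥ 1`. -/
theorem lintegral_psiTwo_le_one {Ω : Type*} [MeasurableSpace Ω] {μ : Measure Ω} {X : Ω → ℝ}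
    (hX : Measurable X) {t : ℝ} (ht : 0 < t)
    (h : ∀ k : ℕ, 1 ≤ k → ∫⁻ ω, ENNReal.ofReal (X ω ^ (2 * k)) ∂μ ≤
      ENNReal.ofReal (1 / 2 * (2 / 3) ^ k * k.factorial * t ^ (2 * k))) :
    ∫⁻ ω, ENNReal.ofReal (psiTwo (|X ω| / t)) ∂μ ≤ 1 := by
  have e : ∀ ω, ENNReal.ofReal (psiTwo (|X ω| / t)) = ∑' k : ℕ,
      ENNReal.ofReal ((t ^ (2 * (k + 1)) * (k + 1).factorial)⁻¹) *
        ENNReal.ofReal (X ω ^ (2 * (k + 1))) := by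
    intro ω
    have hs := hasSum_psiTwo (|X ω| / t)
    rw [← hs.tsum_eq, ENNReal.ofReal_tsum_of_nonneg (fun k => by positivity) hs.summable]
    refine tsum_congr fun k => ?_
    rw [← ENNReal.ofReal_mul (by positivity)]
    congr 1
    rw [div_pow, (even_two_mul (k + 1)).pow_abs]
    field_simp
  simp_rw [e]
  rw [lintegral_tsum fun k => by fun_prop]
  have hsum : HasSum (fun k : ℕ => (1 / 3 : ℝ) * (2 / 3) ^ k) 1 := by
    have := (hasSum_geometric_of_lt_one (r := (2 / 3 : ℝ)) (by norm_num) (by norm_num)).mul_left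
      (1 / 3)
    rwa [show (1 / 3 : ℝ) * (1 - 2 / 3)⁻¹ = 1 by norm_num] at this
  calc _ ≤ ∑' k : ℕ, ENNReal.ofReal (1 / 3 * (2 / 3) ^ k) := by
        refine ENNReal.tsum_le_tsum fun k => ?_
        rw [lintegral_const_mul _ (by fun_prop)]
        refine (mul_le_mul_right (h (k + 1) (by omega)) _).trans (le_of_eq ?_)
        rw [← ENNReal.ofReal_mul (by positivity)]
        congr 1
        have : ((k + 1).factorial : ℝ) ≠ 0 := by exact_mod_cast Nat.factorial_ne_zero _
        field_simp
        ring
    _ = 1 := by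
        rw [← ENNReal.ofReal_tsum_of_nonneg (fun k => by positivity) hsum.summable, hsum.tsum_eq,
          ENNReal.ofReal_one]

/-- `‖θ.ofLp‖` is the norm of `Fin n → ℝ`, that is, the maximum norm. -/
theorem proposition3p1 {n : ℕ} (hn : 1 ≤ n) (K : ConvexBody (EuclideanSpace ℝ (Fin n)))
    (hint : (interior (K : Set (EuclideanSpace ℝ (Fin n)))).Nonempty)
    (hiso : K.IsIsotropic) (hunc : K.IsUnconditional) (θ : EuclideanSpace ℝ (Fin n)) :
    psiTwoNorm
        (fun x : frontier (K : Set (EuclideanSpace ℝ (Fin n))) =>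
          inner ℝ (x : EuclideanSpace ℝ (Fin n)) θ)
        (K.coneMeasure (hunc.zero_mem_interior hint)) ≤
      ENNReal.ofReal (3 * √(n : ℝ) * ‖θ.ofLp‖) := by
  have h0 := hunc.zero_mem_interior hint
  rcases eq_or_ne θ 0 with rfl | hθ
  -- For `θ = 0` the bound is `0`, which is not an admissible `t`; every positive `t` is admissible
  -- and the infimum is `0`.
  · refine le_of_forall_gt_imp_ge_of_dense fun c hc => ?_
    have hc0 : 0 < c := zero_le.trans_lt hc
    obtain ⟨r, hr0, hrc⟩ := ENNReal.lt_iff_exists_nnreal_btwn.1 hc0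
    refine le_trans ?_ hrc.le
    rw [← ENNReal.ofReal_coe_nnreal]
    refine iInf_le_of_le (r : ℝ) (iInf_le_of_le (by exact_mod_cast hr0) (iInf_le_of_le ?_ le_rfl))
    simp [psiTwo]
  · have hn0 : (0 : ℝ) < n := by exact_mod_cast hn
    have hθ' : 0 < ‖θ.ofLp‖ := by
      rw [norm_pos_iff]
      exact fun h => hθ (WithLp.ofLp_injective 2 h)
    have ht : 0 < 3 * √(n : ℝ) * ‖θ.ofLp‖ := by positivity
    refine iInf_le_of_le _ (iInf_le_of_le ht (iInf_le_of_le ?_ le_rfl))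
    refine lintegral_psiTwo_le_one (by fun_prop) ht fun k hk => ?_
    exact hiso.lintegral_coneMeasure_inner_pow_le hn hunc h0 θ hk
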